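/- **Setting.** Let $\Gamma\subset\mathbb R^N$ be a connected network: $\Gamma=\bigcup_{\gamma\in\mathbf E}\gamma([0,|\gamma|])$, where $\mathbf E$ is a nonempty finite collection of $C^1$ simple curves (arcs) of positive length $|\gamma|$, parametrized by arc length and injective on $[0,|\gamma|]$ (so there are no self-loops). The collection is closed under reversal $\tilde\gamma(s)=\gamma(|\gamma|-s)$. Arcs that are neither equal nor reversed to each other meet only at endpoints, and any two vertices (endpoints of arcs; their set is $\mathbf V$) are linked by a finite chain of concatenated arcs. Fix an orientation $\mathbf E^+$, containing exactly one arc of each pair $\{\gamma,\tilde\gamma\}$; let $\mathbf E^+_x$ be the set of the arcs of $\mathbf E^+$ with endpoint $x$. Let $T>0$ and let $g:\Gamma\to\mathbb R$ be Lipschitz continuous. For every $\gamma\in\mathbf E$ let $\tilde H_\gamma:[0,|\gamma|]\times\mathbb R\to\mathbb R$ be continuous, convex in $\mu$, superlinear in $\mu$ uniformly in $s$, and Lipschitz continuous in $s$ for each fixed $\mu$, with $\tilde H_{\tilde\gamma}(s,\mu)=\tilde H_\gamma(|\gamma|-s,-\mu)$. Let $c:\mathbf V\to\mathbb R$ be a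 flux limiter, i.e. $c_x\le -\max_s\min_\mu\tilde H_\gamma(s,\mu)$ for all $x\in\mathbf V$ and $\gamma\in\mathbf E^+_x$. **The problem (HJ).** Test functions are $C^1$; a *subtangent* (*supertangent*) at a point is a test function $\varphi$ such that $u-\varphi$ has a local minimum (maximum) there, relative to the domain of $u$. A continuous $u:\Gamma\times[0,T]\to\mathbb R$ is a *subsolution* of (HJ) if $u(\cdot,0)\le g$; for every $\gamma\in\mathbf E$ the function $u\circ\gamma(s,t):=u(\gamma(s),t)$ is a viscosity subsolution of $w_t+\tilde H_\gamma(s,w')=0$ in $(0,|\gamma|)\times(0,T)$; and for all $x\in\mathbf V$, $t_0\in(0,T]$, every supertangent $\psi$ to $u(x,\cdot)$ at $t_0$ satisfies $\psi'(t_0)\le c_x$. It is a *supersolution* if $u(\cdot,0)\ge g$; for every $\gamma\in\mathbf E$ the function $u\circ\gamma$ is a viscosity supersolution of the same equation; and for all $x\in\mathbf V$, $t_0\in(0,T]$: if some subtangent $\psi$ to $u(x,\cdot)$ at $t_0$ has $\psi'(t_0)<c_x$, then there is $\gamma\in\mathbf E^+_x$ such that, with $s_0=\gamma^{-1}(x)$,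 every subtangent $\varphi$ to $u\circ\gamma$ at $(s_0,t_0)$ constrained to $[0,|\gamma|]\times[0,T]$ satisfies $\varphi_t(s_0,t_0)+\tilde H_\gamma(s_0,\varphi'(s_0,t_0))\ge0$. It is a *solution* if it is both. **The momentum interval.** Set $\tilde M_0=\max_\gamma\min\{m:\tilde H_\gamma(s,(g\circ\gamma)'(s))\le m\text{ for a.e. }s\in[0,|\gamma|]\}$ and $A=\max\{\tilde M_0+1,\max_{x\in\mathbf V}|c_x|\}$. Let $I$ be a compact interval such that every $\mu_0\notin I$ satisfies $$|\mu_0|>\max_\gamma\mathrm{Lip}(g\circ\gamma)\quad\text{and}\quad\tilde H_\gamma(s,\mu)>A\ \text{ for all }|\mu|\ge|\mu_0|,\ \gamma\in\mathbf E,\ s\in[0,|\gamma|].\tag{mod2}$$ **The modified problem (HJmod).** For each $\gamma$ choose $\beta_0>\beta$, where $\beta\ge 0$ is a Lipschitz constant of $\tilde H_\gamma$ on $[0,|\gamma|]\times\tilde I$ for some compact interval $\tilde I$ containing $I$ in its interior, and $\mu_*>0$ such that, for all $s\in[0,|\gamma|]$, $\tilde H_\gamma(s,\mu)>\tilde H_\gamma(s,-\mu_*)-\beta_0(\mu+\mu_*)$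 for $\mu<-\mu_*$ and $\tilde H_\gamma(s,\mu)>\tilde H_\gamma(s,\mu_*)+\beta_0(\mu-\mu_*)$ for $\mu>\mu_*$, with the same $\beta_0,\mu_*$ for $\gamma$ and $\tilde\gamma$. Let $H_\gamma(s,\cdot)$ be the convex envelope of the function that equals $\tilde H_\gamma(s,\cdot)$ on $[-\mu_*,\mu_*]$, $\tilde H_\gamma(s,-\mu_*)-\beta_0(\mu+\mu_*)$ for $\mu<-\mu_*$ and $\tilde H_\gamma(s,\mu_*)+\beta_0(\mu-\mu_*)$ for $\mu>\mu_*$. (HJmod) is (HJ) with $H_\gamma$ in place of $\tilde H_\gamma$, with the same $g$ and $c_x$. **Theorem 2.3.** Under these assumptions the solutions of (HJ) and (HJmod) coincide: a function $u$ is a solution of (HJ) if and only if it is a solution of (HJmod), and any solution of (HJ) equals any solution of (HJmod) on $\Gamma\times[0,T]$. Moreover, every subsolution of (HJ) is a subsolution of (HJmod), and every subsolution $u$ of (HJmod) with $|u(x,t)-u(x,t')|\le A|t-t'|$ for all $x\in\Gamma$, $t,t'\in[0,T]$ is a subsolution of (HJ). -/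

import Mathlib

open Set MeasureTheory

noncomputable section

namespace HJNetwork

/-- A connected network in `ℝ^d`: a finite family of regular simple curves (arcs), parametrized by
arc length, closed under reversal, two arcs with different supports meeting only at endpoints.
Injectivity of each arc on the closed parameter interval says that arcs are simple and that there
are no self-loops. Only the values of `curve e` on `[0, len e]` matter. -/
structure Network (d : ℕ) where
  /-- (indices of) the oriented arcs -/
  Arc : Type
  finite_arc : Finite Arc
  nonempty_arc : Nonempty Arc
  /-- the length of an arc -/
  len : Arc → ℝ
  len_pos : ∀ e, 0 < len e
  /-- the arc length parametrization -/
  curve : Arc → ℝ → EuclideanSpace ℝ (Fin d)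
  contDiffOn_curve : ∀ e, ContDiffOn ℝ 1 (curve e) (Icc 0 (len e))
  unit_speed : ∀ e, ∀ s ∈ Icc 0 (len e), ‖derivWithin (curve e) (Icc 0 (len e)) s‖ = 1
  injOn_curve : ∀ e, InjOn (curve e) (Icc 0 (len e))
  /-- the reversed arc -/
  rev : Arc → Arc
  rev_rev : ∀ e, rev (rev e) = e
  len_rev : ∀ e, len (rev e) = len e
  curve_rev : ∀ e, ∀ s ∈ Icc 0 (len e), curve (rev e) s = curve e (len e - s)
  meet_only_at_endpoints : ∀ e e', e' ≠ e → e' ≠ rev e →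
    ∀ s ∈ Icc 0 (len e), ∀ s' ∈ Icc 0 (len e'), curve e s = curve e' s' →
      (s = 0 ∨ s = len e) ∧ (s' = 0 ∨ s' = len e')
  /-- any two endpoints of arcs are linked by a finite sequence of concatenated arcs -/
  connected : ∀ e₁ e₂, Relation.ReflTransGen
    (fun x y => ∃ e, curve e 0 = x ∧ curve e (len e) = y) (curve e₁ 0) (curve e₂ 0)

namespace Network

variable {d : ℕ} (N : Network d)

/-- The support of the network. -/
def support : Set (EuclideanSpace ℝ (Fin d)) := ⋃ e, N.curve e '' Icc 0 (N.len e)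

/-- The vertices: initial and final points of arcs. -/
def vertices : Set (EuclideanSpace ℝ (Fin d)) :=
  {x | ∃ e, x = N.curve e 0 ∨ x = N.curve e (N.len e)}

/-- An orientation: exactly one arc in each pair of mutually reversed arcs. -/
def IsOrientation (P : Set N.Arc) : Prop := ∀ e, (e ∈ P ↔ N.rev e ∉ P)

/-- Hypotheses on a family of Hamiltonians indexed by arcs; `Ht e s μ` is relevant only for
`s ∈ [0, len e]`. -/
structure IsHamiltonian (Ht : N.Arc → ℝ → ℝ → ℝ) : Prop where
  compat : ∀ e, ∀ s ∈ Icc 0 (N.len e), ∀ μ, Ht (N.rev e) s μ = Ht e (N.len e - s) (-μ)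
  cont : ∀ e, ContinuousOn (fun p : ℝ × ℝ => Ht e p.1 p.2) (Icc 0 (N.len e) ×ˢ univ)
  convex : ∀ e, ∀ s ∈ Icc 0 (N.len e), ConvexOn ℝ univ (Ht e s)
  /-- superlinearity in the momentum, uniformly in `s` -/
  superlinear : ∀ e, ∀ K : ℝ, ∃ R : ℝ, ∀ s ∈ Icc 0 (N.len e), ∀ μ, R ≤ |μ| →
    K * |μ| ≤ Ht e s μ
  lipschitz : ∀ e, ∀ μ, ∃ K, LipschitzOnWith K (fun s => Ht e s μ) (Icc 0 (N.len e))

/-- `c̃_γ = - max_s min_μ H̃_γ(s,μ)`. -/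
def fluxBound (Ht : N.Arc → ℝ → ℝ → ℝ) (e : N.Arc) : ℝ :=
  -(⨆ s : Icc 0 (N.len e), ⨅ μ : ℝ, Ht e s μ)

/-- Flux limiters: `c_x ≤ c̃_γ` for every arc `γ` of the orientation incident on the vertex `x`. -/
def IsFluxLimiter (P : Set N.Arc) (Ht : N.Arc → ℝ → ℝ → ℝ) (c : N.vertices → ℝ) : Prop :=
  ∀ x : N.vertices, ∀ e ∈ P,
    ((x : EuclideanSpace ℝ (Fin d)) = N.curve e 0 ∨
      (x : EuclideanSpace ℝ (Fin d)) = N.curve e (N.len e)) → c x ≤ N.fluxBound Ht e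

end Network

/-! ### Viscosity solutions -/

/-- The value `φ_t + H(s, φ')` at `(s,t)`, for `φ` a function of `(s,t)`. -/
def residual (H : ℝ → ℝ → ℝ) (φ : ℝ × ℝ → ℝ) (s t : ℝ) : ℝ :=
  deriv (fun τ => φ (s, τ)) t + H s (deriv (fun σ => φ (σ, t)) s)

/-- Viscosity subsolution of `w_t + H(s, w') = 0` in `(0,l) × (0,T)`. -/
def IsViscSub (H : ℝ → ℝ → ℝ) (l T : ℝ) (w : ℝ × ℝ → ℝ) : Prop :=
  ∀ s ∈ Ioo 0 l, ∀ t ∈ Ioo 0 T, ∀ φ : ℝ × ℝ → ℝ, ContDiff ℝ 1 φ →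
    IsLocalMax (fun p => w p - φ p) (s, t) → residual H φ s t ≤ 0

/-- Viscosity supersolution of `w_t + H(s, w') = 0` in `(0,l) × (0,T)`. -/
def IsViscSuper (H : ℝ → ℝ → ℝ) (l T : ℝ) (w : ℝ × ℝ → ℝ) : Prop :=
  ∀ s ∈ Ioo 0 l, ∀ t ∈ Ioo 0 T, ∀ φ : ℝ × ℝ → ℝ, ContDiff ℝ 1 φ →
    IsLocalMin (fun p => w p - φ p) (s, t) → 0 ≤ residual H φ s t

namespace Network

variable {d : ℕ} (N : Network d)

/-- Vertex condition for supersolutions: if some `C¹` subtangent `ψ` to `u(x,·)` at `t₀ ∈ (0,T]` has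
`ψ'(t₀) < c_x`, then there is an arc `e` of the orientation incident on `x`, with `x = curve e s`,
such that all `C¹` subtangents to `u ∘ e` at `(s,t₀)` constrained to `[0,len e] × [0,T]` satisfy
`φ_t + H_e(s, φ') ≥ 0`. -/
def VertexSuper (P : Set N.Arc) (H : N.Arc → ℝ → ℝ → ℝ) (c : N.vertices → ℝ) (T : ℝ)
    (u : EuclideanSpace ℝ (Fin d) → ℝ → ℝ) : Prop :=
  ∀ x : N.vertices, ∀ t₀ ∈ Ioc 0 T,
    (∃ ψ : ℝ → ℝ, ContDiff ℝ 1 ψ ∧ IsLocalMinOn (fun t => u x t - ψ t) (Icc 0 T) t₀ ∧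
      deriv ψ t₀ < c x) →
    ∃ e ∈ P, ∃ s : ℝ, (s = 0 ∨ s = N.len e) ∧ N.curve e s = x ∧
      ∀ φ : ℝ × ℝ → ℝ, ContDiff ℝ 1 φ →
        IsLocalMinOn (fun p : ℝ × ℝ => u (N.curve e p.1) p.2 - φ p)
          (Icc 0 (N.len e) ×ˢ Icc 0 T) (s, t₀) →
        0 ≤ residual (H e) φ s t₀

/-- Vertex condition for subsolutions: all `C¹` supertangents `ψ` to `u(x,·)` at `t₀ ∈ (0,T]`
satisfy `ψ'(t₀) ≤ c_x`. -/
def VertexSub (c : N.vertices → ℝ) (T : ℝ) (u : EuclideanSpace ℝ (Fin d) → ℝ → ℝ) : Prop :=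
  ∀ x : N.vertices, ∀ t₀ ∈ Ioc 0 T, ∀ ψ : ℝ → ℝ, ContDiff ℝ 1 ψ →
    IsLocalMaxOn (fun t => u x t - ψ t) (Icc 0 T) t₀ → deriv ψ t₀ ≤ c x

/-- Subsolutions of the evolutive problem on the network, with Hamiltonians `H`, initial datum `g`
and flux limiter `c`. Only the values of `u` on `support × [0,T]` matter. -/
structure IsSubsolution (H : N.Arc → ℝ → ℝ → ℝ) (g : EuclideanSpace ℝ (Fin d) → ℝ)
    (c : N.vertices → ℝ) (T : ℝ) (u : EuclideanSpace ℝ (Fin d) → ℝ → ℝ) : Prop where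
  cont : ContinuousOn (fun p : EuclideanSpace ℝ (Fin d) × ℝ => u p.1 p.2)
    (N.support ×ˢ Icc 0 T)
  initial : ∀ x ∈ N.support, u x 0 ≤ g x
  interior : ∀ e, IsViscSub (H e) (N.len e) T (fun p => u (N.curve e p.1) p.2)
  vertex : N.VertexSub c T u

/-- Supersolutions of the evolutive problem on the network. -/
structure IsSupersolution (P : Set N.Arc) (H : N.Arc → ℝ → ℝ → ℝ)
    (g : EuclideanSpace ℝ (Fin d) → ℝ) (c : N.vertices → ℝ) (T : ℝ)
    (u : EuclideanSpace ℝ (Fin d) → ℝ → ℝ) : Prop where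
  cont : ContinuousOn (fun p : EuclideanSpace ℝ (Fin d) × ℝ => u p.1 p.2)
    (N.support ×ˢ Icc 0 T)
  initial : ∀ x ∈ N.support, g x ≤ u x 0
  interior : ∀ e, IsViscSuper (H e) (N.len e) T (fun p => u (N.curve e p.1) p.2)
  vertex : N.VertexSuper P H c T u

/-- Solutions of the evolutive problem on the network. -/
def IsSolution (P : Set N.Arc) (H : N.Arc → ℝ → ℝ → ℝ) (g : EuclideanSpace ℝ (Fin d) → ℝ)
    (c : N.vertices → ℝ) (T : ℝ) (u : EuclideanSpace ℝ (Fin d) → ℝ → ℝ) : Prop :=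
  N.IsSubsolution H g c T u ∧ N.IsSupersolution P H g c T u

end Network

/-! ### The modified Hamiltonians -/

/-- Parameters `β₀`, `μ₀` admissible for modifying the Hamiltonian `Ht` on `[0,a] × ℝ` outside the
compact interval `[i₁,i₂]` of momenta: `β₀ > β` for a Lipschitz constant `β` of `Ht` on
`[0,a] × [j₁,j₂]`, where `[j₁,j₂]` is a compact neighborhood of `[i₁,i₂]`, and `μ₀ > 0` is such that
`Ht(s,·)` lies strictly above the half-lines of slopes `∓β₀` starting at `∓μ₀`. -/
structure IsCutoff (Ht : ℝ → ℝ → ℝ) (a i₁ i₂ β₀ μ₀ : ℝ) : Prop where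
  slope : ∃ j₁ j₂ β : ℝ, j₁ < i₁ ∧ i₂ < j₂ ∧ 0 ≤ β ∧ β < β₀ ∧
    ∀ s ∈ Icc 0 a, ∀ s' ∈ Icc 0 a, ∀ μ ∈ Icc j₁ j₂, ∀ μ' ∈ Icc j₁ j₂,
      |Ht s μ - Ht s' μ'| ≤ β * (|s - s'| + |μ - μ'|)
  pos : 0 < μ₀
  left : ∀ s ∈ Icc 0 a, ∀ μ, μ < -μ₀ → Ht s (-μ₀) - β₀ * (μ + μ₀) < Ht s μ
  right : ∀ s ∈ Icc 0 a, ∀ μ, μ₀ < μ → Ht s μ₀ + β₀ * (μ - μ₀) < Ht s μ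

/-- `Ht` on `[-μ₀, μ₀]`, continued linearly with slopes `∓β₀` outside. -/
def linearTails (Ht : ℝ → ℝ → ℝ) (β₀ μ₀ s μ : ℝ) : ℝ :=
  if μ < -μ₀ then Ht s (-μ₀) - β₀ * (μ + μ₀)
  else if μ₀ < μ then Ht s μ₀ + β₀ * (μ - μ₀)
  else Ht s μ

/-- The convex envelope: pointwise supremum of the convex functions not exceeding `f`. -/
def convexEnvelope (f : ℝ → ℝ) (μ : ℝ) : ℝ :=
  sSup {y | ∃ h : ℝ → ℝ, ConvexOn ℝ univ h ∧ (∀ ν, h ν ≤ f ν) ∧ y = h μ}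

/-- The modified Hamiltonian. -/
def modifiedH (Ht : ℝ → ℝ → ℝ) (β₀ μ₀ s : ℝ) : ℝ → ℝ :=
  convexEnvelope (linearTails Ht β₀ μ₀ s)

/-! ### The constants governing the choice of the momentum interval -/

/-- The best Lipschitz constant of a real function on a set of reals. -/
def bestLip (f : ℝ → ℝ) (S : Set ℝ) : ℝ :=
  sInf {K | 0 ≤ K ∧ ∀ x ∈ S, ∀ y ∈ S, |f x - f y| ≤ K * |x - y|}

namespace Network

variable {d : ℕ} (N : Network d)

/-- `max_γ Lip(g ∘ γ)`. -/
def maxLip (g : EuclideanSpace ℝ (Fin d) → ℝ) : ℝ :=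
  ⨆ e : N.Arc, bestLip (fun s => g (N.curve e s)) (Icc 0 (N.len e))

/-- `M̃₀ = max_γ min {m | H̃_γ(s, (g ∘ γ)'(s)) ≤ m for a.e. s ∈ [0,|γ|]}`. -/
def M0 (Ht : N.Arc → ℝ → ℝ → ℝ) (g : EuclideanSpace ℝ (Fin d) → ℝ) : ℝ :=
  ⨆ e : N.Arc, sInf {m : ℝ | ∀ᵐ s ∂(volume.restrict (Icc 0 (N.len e))),
    Ht e s (deriv (fun σ => g (N.curve e σ)) s) ≤ m}

/-- `(M̃₀ + 1) ∨ max_x |c_x|`. -/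
def level (Ht : N.Arc → ℝ → ℝ → ℝ) (g : EuclideanSpace ℝ (Fin d) → ℝ) (c : N.vertices → ℝ) : ℝ :=
  max (N.M0 Ht g + 1) (⨆ x : N.vertices, |c x|)

/-- The condition on the momentum interval `I`. -/
def MomentumCondition (Ht : N.Arc → ℝ → ℝ → ℝ) (g : EuclideanSpace ℝ (Fin d) → ℝ)
    (c : N.vertices → ℝ) (I : Set ℝ) : Prop :=
  ∀ μ₀, μ₀ ∉ I → N.maxLip g < |μ₀| ∧
    ∀ μ, |μ₀| ≤ |μ| → ∀ e, ∀ s ∈ Icc 0 (N.len e), N.level Ht g c < Ht e s μ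

end Network

end HJNetwork

end

open Set MeasureTheory

noncomputable section

namespace HJNetwork

/-! Write `A` for `N.level Ht g c`. By the choice of the momentum interval, the modified Hamiltonian
coincides with the original one wherever its value is at most `A` (`exists_modifiedH_eq`,
`lt_modifiedH`), and it never exceeds it (`modifiedH_le`). The inequality alone carries subsolutions
of (HJ) to (HJmod) and supersolutions of (HJmod) to (HJ). For the other two passages it is enough
that every test function at a contact point has time derivative at least `-A`. In the subsolution
inequality the modified Hamiltonian is then at most `A`, where the two agree; in the supersolution
inequality, a modified value above `A` already makes the residual positive
(`IsSubsolution.of_time_lower_bound`, `IsSupersolution.of_time_lower_bound`).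

The bound `-A` holds for every solution `u` of either problem (`IsSolution.time_lower_bound`).
Indeed `g - A t` is a subsolution, so `u(·,h) ≥ g - A h` by comparison; then `u(·, · + h) + A h` is
a supersolution with initial datum above that of `u`, and a second comparison gives `u(·,t) ≤
u(·,t+h) + A h`.

Everything thus rests on a comparison principle for merely continuous sub- and supersolutions
(`comparison`). Only time is doubled on the whole network. At a maximizer interior to an arc,
doubling space gives the usual contradiction (`false_of_interior_max`). At a vertex
(`false_of_vertex_max`), the subsolution condition bounds the common time slope strictly below `c
x`, so the supersolution must satisfy its inequality along some arc. On that arc the flux limiter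
provides a decreasing line below the Hamiltonian near the vertex (`IsCoerciveH.exists_line`). The
subsolution is controlled along the space-time lines of the corresponding speed
(`IsViscSub.transport`), and the maximality turns this control into a subtangent with negative
residual (`exists_subtangent_left`). -/

/-! ### Convex functions on the line -/

/-- A convex function on the line has a supporting line at every point. -/
lemma exists_support_line {f : ℝ → ℝ} (hf : ConvexOn ℝ univ f) (x : ℝ) :
    ∃ p, ∀ y, f x + p * (y - x) ≤ f y := by
  have hx : x ∈ interior (univ : Set ℝ) := by simp
  refine ⟨derivWithin f (Ioi x) x, fun y => ?_⟩
  rcases lt_trichotomy x y with h | h | h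
  · have := hf.rightDeriv_le_slope_of_mem_interior hx (mem_univ y) h
    rw [slope_def_field, le_div_iff₀ (by linarith)] at this
    linarith
  · simp [h]
  · have h1 := hf.slope_le_leftDeriv_of_mem_interior (mem_univ y) hx h
    have h2 := hf.leftDeriv_le_rightDeriv_of_mem_interior hx
    have h3 := h1.trans h2
    rw [slope_def_field, div_le_iff₀ (by linarith)] at h3
    linarith

/-- A convex function lies above its chords, extended to the right. -/
lemma convex_chord_right {f : ℝ → ℝ} (hf : ConvexOn ℝ univ f) {x y z : ℝ} (hxy : x < y)
    (hyz : y ≤ z) : (f y - f x) * (z - y) ≤ (f z - f y) * (y - x) := by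
  rcases hyz.eq_or_lt with rfl | hyz
  · simp
  have := hf.slope_mono_adjacent (mem_univ x) (mem_univ z) hxy hyz
  rwa [div_le_div_iff₀ (by linarith) (by linarith)] at this

/-- A convex function lies above its chords, extended to the left. -/
lemma convex_chord_left {f : ℝ → ℝ} (hf : ConvexOn ℝ univ f) {x y z : ℝ} (hxy : x ≤ y)
    (hyz : y < z) : (f y - f x) * (z - y) ≤ (f z - f y) * (y - x) := by
  rcases hxy.eq_or_lt with rfl | hxy
  · simp
  have := hf.slope_mono_adjacent (mem_univ x) (mem_univ z) hxy hyz
  rwa [div_le_div_iff₀ (by linarith) (by linarith)] at this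

/-! ### The convex envelope -/

section Envelope

variable {f : ℝ → ℝ} {h₀ : ℝ → ℝ}

lemma le_convexEnvelope {h : ℝ → ℝ} (hc : ConvexOn ℝ univ h) (hle : ∀ ν, h ν ≤ f ν) (μ : ℝ) :
    h μ ≤ convexEnvelope f μ :=
  le_csSup ⟨f μ, by rintro y ⟨k, -, hk, rfl⟩; exact hk μ⟩ ⟨h, hc, hle, rfl⟩

/-- The minorant `h₀` matters: without one, the supremum is over the empty set and takes the default
value `0`. -/
lemma convexEnvelope_le_of_forall (hc₀ : ConvexOn ℝ univ h₀) (hle₀ : ∀ ν, h₀ ν ≤ f ν) {μ b : ℝ}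
    (hb : ∀ h : ℝ → ℝ, ConvexOn ℝ univ h → (∀ ν, h ν ≤ f ν) → h μ ≤ b) :
    convexEnvelope f μ ≤ b :=
  csSup_le ⟨_, h₀, hc₀, hle₀, rfl⟩ (by rintro y ⟨h, h1, h2, rfl⟩; exact hb h h1 h2)

lemma convexEnvelope_le (hc₀ : ConvexOn ℝ univ h₀) (hle₀ : ∀ ν, h₀ ν ≤ f ν) (μ : ℝ) :
    convexEnvelope f μ ≤ f μ :=
  convexEnvelope_le_of_forall hc₀ hle₀ fun _ _ h => h μ

lemma convexOn_convexEnvelope (hc₀ : ConvexOn ℝ univ h₀) (hle₀ : ∀ ν, h₀ ν ≤ f ν) :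
    ConvexOn ℝ univ (convexEnvelope f) := by
  refine ⟨convex_univ, fun x _ y _ a b ha hb hab => ?_⟩
  refine convexEnvelope_le_of_forall hc₀ hle₀ fun h hc hle => ?_
  refine (hc.2 (mem_univ x) (mem_univ y) ha hb hab).trans ?_
  simp only [smul_eq_mul]
  gcongr
  · exact le_convexEnvelope hc hle x
  · exact le_convexEnvelope hc hle y

/-- Lowering a convex minorant of `f` by `ω` gives one of `f'`. Hence the envelope inherits uniform
closeness, which yields continuity in `s`. -/
lemma convexEnvelope_le_add {f' : ℝ → ℝ} {ω : ℝ} (hc₀ : ConvexOn ℝ univ h₀)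
    (hle₀ : ∀ ν, h₀ ν ≤ f ν) (hff' : ∀ ν, f ν ≤ f' ν + ω) (μ : ℝ) :
    convexEnvelope f μ ≤ convexEnvelope f' μ + ω := by
  refine convexEnvelope_le_of_forall hc₀ hle₀ fun h hc hle => ?_
  have := le_convexEnvelope (f := f') (h := fun ν => h ν + -ω) (hc.add_const (-ω))
    (fun ν => by linarith [hle ν, hff' ν]) μ
  linarith

end Envelope

/-! ### Hamiltonians on a segment -/

/-- Continuous Hamiltonians on `[0,l] × ℝ`, convex and coercive in the momentum. -/
structure IsCoerciveH (H : ℝ → ℝ → ℝ) (l : ℝ) : Prop where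
  cont : ContinuousOn (fun p : ℝ × ℝ => H p.1 p.2) (Icc 0 l ×ˢ univ)
  convex : ∀ s ∈ Icc 0 l, ConvexOn ℝ univ (H s)
  coercive : ∀ C : ℝ, ∃ R : ℝ, ∀ s ∈ Icc 0 l, ∀ μ, R ≤ |μ| → C ≤ H s μ

lemma IsCoerciveH.continuousOn_left {H : ℝ → ℝ → ℝ} {l : ℝ} (h : IsCoerciveH H l) (μ : ℝ) :
    ContinuousOn (fun s => H s μ) (Icc 0 l) :=
  h.cont.comp (f := fun s : ℝ => (s, μ)) (by fun_prop) (fun s hs => ⟨hs, mem_univ _⟩)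

lemma IsCoerciveH.continuous_right {H : ℝ → ℝ → ℝ} {l : ℝ} (h : IsCoerciveH H l) {s : ℝ}
    (hs : s ∈ Icc 0 l) : Continuous (H s) := by
  rw [← continuousOn_univ]
  exact h.cont.comp (f := fun μ : ℝ => (s, μ)) (by fun_prop) (fun μ hμ => ⟨hs, hμ⟩)

lemma IsCoerciveH.exists_min {H : ℝ → ℝ → ℝ} {l : ℝ} (h : IsCoerciveH H l) {s : ℝ}
    (hs : s ∈ Icc 0 l) : ∃ q, ∀ μ, H s q ≤ H s μ := by
  obtain ⟨R, hR⟩ := h.coercive (H s 0)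
  have hne : (Icc (-|R|) |R|).Nonempty := ⟨0, by simp⟩
  obtain ⟨q, -, hq⟩ := isCompact_Icc.exists_isMinOn hne (h.continuous_right hs).continuousOn
  refine ⟨q, fun μ => ?_⟩
  by_cases hμ : μ ∈ Icc (-|R|) |R|
  · exact hq hμ
  · have h0 : H s q ≤ H s 0 := hq (by simp)
    have : R ≤ |μ| := by
      by_contra! hlt
      exact hμ (abs_le.mp (hlt.le.trans (le_abs_self R)))
    exact h0.trans (hR s hs μ this)

/-- Reversal of the parameter preserves coercive Hamiltonians. -/
lemma IsCoerciveH.reflect {H : ℝ → ℝ → ℝ} {l : ℝ} (h : IsCoerciveH H l) :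
    IsCoerciveH (fun s μ => H (l - s) (-μ)) l where
  cont := h.cont.comp (f := fun p : ℝ × ℝ => (l - p.1, -p.2)) (by fun_prop) (by
    rintro ⟨s, μ⟩ ⟨⟨h1, h2⟩, -⟩
    exact ⟨⟨by simpa using h2, by simpa using h1⟩, mem_univ _⟩)
  convex s hs := by
    have := (h.convex (l - s) ⟨by linarith [hs.2], by linarith [hs.1]⟩).comp_linearMap
      (-LinearMap.id)
    simpa [Function.comp_def] using this
  coercive C := by
    obtain ⟨R, hR⟩ := h.coercive C
    exact ⟨R, fun s hs μ hμ => hR _ ⟨by linarith [hs.2], by linarith [hs.1]⟩ _ (by simpa using hμ)⟩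

/-- A decreasing line lies below a convex function as soon as it does so, in a robust way, at four
momenta `p₀ < p₁ < q < R`. -/
lemma line_le_of_convex {f : ℝ → ℝ} (hf : ConvexOn ℝ univ f) {b κ κs p₀ p₁ q R : ℝ}
    (hp : p₀ < p₁) (hpq : p₁ < q) (hqR : q < R) (hκ : 0 < κ) (h1 : f q < f p₁) (h2 : f q < f R)
    (h3 : b ≤ f R) (h4 : κ ≤ κs) (hκs : f p₀ - f p₁ = κs * (p₁ - p₀))
    (h5 : f p₀ - f p₁ ≤ f p₁ - b) (h6 : (κs - κ) * (R - p₁) ≤ f p₁ - b) (μ : ℝ) :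
    b - κ * (μ - p₁) ≤ f μ := by
  have hp' : 0 < p₁ - p₀ := sub_pos.2 hp
  have hm4 : κ * (p₁ - p₀) ≤ κs * (p₁ - p₀) := mul_le_mul_of_nonneg_right h4 hp'.le
  -- Left of `p₀` the secant through `p₀` and `p₁` extends below `f` and is at least as steep as the
  -- line.
  rcases le_total μ p₀ with hμ | hμ
  · have h := convex_chord_left hf hμ hp
    have e : f p₁ - f p₀ = -(κs * (p₁ - p₀)) := by linarith
    rw [e] at h
    have h' : (f p₀ - f μ) * (p₁ - p₀) ≤ (-(κs * (p₀ - μ))) * (p₁ - p₀) := by linarith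
    have h'' := le_of_mul_le_mul_right h' hp'
    have := mul_le_mul_of_nonneg_right h4 (sub_nonneg.2 hμ)
    have : 0 ≤ κ * (p₁ - p₀) := by positivity
    linarith
  -- On `[p₀, p₁]` convexity and `f q < f p₁` give `f ≥ f p₁`, and by `h5` the line has not yet
  -- climbed above `f p₁`.
  rcases le_total μ p₁ with hμ1 | hμ1
  · have h := convex_chord_left hf hμ1 hpq
    have h' : f p₁ ≤ f μ := by
      have : (f p₁ - f μ) * (q - p₁) ≤ 0 * (q - p₁) := by
        rw [zero_mul]
        exact h.trans (mul_nonpos_of_nonpos_of_nonneg (by linarith) (by linarith))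
      linarith [le_of_mul_le_mul_right this (sub_pos.2 hpq)]
    have := mul_nonneg hκ.le (sub_nonneg.2 hμ)
    linarith
  -- Up to `R` the extended secant loses height to the line at rate `κs - κ`, which `h6` controls;
  -- beyond `R`, `f ≥ f R ≥ b` and the line is below `b`.
  rcases le_total μ R with hμ2 | hμ2
  · have h := convex_chord_right hf hp hμ1
    have e : f p₁ - f p₀ = -(κs * (p₁ - p₀)) := by linarith
    rw [e] at h
    have h' : (-(κs * (μ - p₁))) * (p₁ - p₀) ≤ (f μ - f p₁) * (p₁ - p₀) := by linarith
    have h'' := le_of_mul_le_mul_right h' hp'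
    have := mul_le_mul_of_nonneg_left (sub_le_sub_right hμ2 p₁) (sub_nonneg.2 h4)
    linarith
  · have h := convex_chord_right hf hqR hμ2
    have h' : f R ≤ f μ := by
      have : 0 * (R - q) ≤ (f μ - f R) * (R - q) := by
        rw [zero_mul]
        exact le_trans (mul_nonneg (by linarith) (by linarith)) h
      linarith [le_of_mul_le_mul_right this (sub_pos.2 hqR)]
    have := mul_nonneg hκ.le (show (0:ℝ) ≤ μ - p₁ by linarith)
    linarith

/-- Near `s = 0`, there is a decreasing line lying below the Hamiltonians `H s`, which passes at
height `b₁` through a momentum where `H 0` is below `b₂`. -/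
lemma IsCoerciveH.exists_line {H : ℝ → ℝ → ℝ} {l b₁ b₂ : ℝ} (h : IsCoerciveH H l) (hl : 0 < l)
    (hb : b₁ < b₂) (hq : ∃ q, H 0 q ≤ b₁) :
    ∃ κ > 0, ∃ p, H 0 p < b₂ ∧ ∃ σ ∈ Ioc 0 l, ∀ s ∈ Ioo 0 σ, ∀ μ,
      b₁ - κ * (μ - p) ≤ H s μ := by
  obtain ⟨q, hq⟩ := hq
  have h0 : (0 : ℝ) ∈ Icc 0 l := ⟨le_rfl, hl.le⟩
  have hc := h.continuous_right h0
  set η := (b₂ - b₁) / 2 with hη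
  have hη0 : 0 < η := by rw [hη]; linarith
  obtain ⟨R₀, hR₀⟩ := h.coercive (b₁ + 2 * η)
  set m := min (-|R₀|) (q - 1)
  have hm : b₁ + 2 * η ≤ H 0 m := hR₀ 0 h0 m (by
    rw [abs_of_nonpos ((min_le_left _ _).trans (by simp))]
    have : m ≤ -|R₀| := min_le_left _ _
    linarith [le_abs_self R₀])
  have hmq : m ≤ q := (min_le_right _ _).trans (by linarith)
  -- Both `p₁` and `p₀` lie left of `q`. The drop `η / 2` from `p₀` to `p₁` is smaller than the
  -- height `η` of `p₁` above `b₁`, which is `h5` of `line_le_of_convex` with room to spare.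
  obtain ⟨p₁, ⟨hmp₁, hp₁q⟩, hp₁⟩ : ∃ p₁ ∈ Icc m q, H 0 p₁ = b₁ + η :=
    intermediate_value_Icc' hmq hc.continuousOn ⟨by linarith, by linarith⟩
  obtain ⟨p₀, ⟨hmp₀, hp₀p₁⟩, hp₀⟩ : ∃ p₀ ∈ Icc m p₁, H 0 p₀ = b₁ + 3 / 2 * η :=
    intermediate_value_Icc' hmp₁ hc.continuousOn ⟨by linarith, by linarith⟩
  have hlt1 : p₁ < q := lt_of_le_of_ne hp₁q (by rintro rfl; linarith)
  have hlt0 : p₀ < p₁ := lt_of_le_of_ne hp₀p₁ (by rintro rfl; linarith)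
  set R := max |R₀| (q + 1)
  have hR : b₁ + 2 * η ≤ H 0 R := hR₀ 0 h0 R (by
    exact (le_abs_self _).trans ((le_max_left _ _).trans (le_abs_self _)))
  have hqR : q < R := lt_of_lt_of_le (by linarith) (le_max_right _ _)
  set κ₀ := (H 0 p₀ - H 0 p₁) / (p₁ - p₀) with hκ₀
  have hκ₀pos : 0 < κ₀ := div_pos (by linarith) (by linarith)
  -- Lowering the secant slope by `ρ` makes `h4` strict, while `ρ * (R - p₁) < η` keeps `h6` strict;
  -- strict inequalities persist for `s` near `0`.
  set ρ := min (κ₀ / 2) (η / (2 * (R - p₁)))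
  have hρ0 : 0 < ρ := lt_min (by linarith) (div_pos hη0 (by linarith))
  have hρ1 : ρ < κ₀ := lt_of_le_of_lt (min_le_left _ _) (by linarith)
  have hρ2 : ρ * (R - p₁) < η := by
    have : ρ ≤ η / (2 * (R - p₁)) := min_le_right _ _
    rw [le_div_iff₀ (by linarith)] at this
    linarith
  set κ := κ₀ - ρ with hκ
  -- five strict inequalities, stable for `s` near `0`
  have hcont : ∀ μ, ContinuousWithinAt (fun s => H s μ) (Icc 0 l) 0 :=
    fun μ => h.continuousOn_left μ 0 h0
  have e1 : ∀ᶠ s in nhdsWithin 0 (Icc 0 l), H s q < H s p₁ :=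
    (hcont q).tendsto.eventually_lt (hcont p₁) (by linarith)
  have e2 : ∀ᶠ s in nhdsWithin 0 (Icc 0 l), H s q < H s R :=
    (hcont q).tendsto.eventually_lt (hcont R) (by linarith)
  have e3 : ∀ᶠ s in nhdsWithin 0 (Icc 0 l), b₁ < H s R :=
    (hcont R).tendsto.eventually_const_lt (by linarith)
  have c4 : ContinuousWithinAt (fun s => (H s p₀ - H s p₁) / (p₁ - p₀)) (Icc 0 l) 0 :=
    ((hcont p₀).sub (hcont p₁)).div_const (p₁ - p₀)
  have c5 : ContinuousWithinAt (fun s => H s p₀ - H s p₁) (Icc 0 l) 0 := (hcont p₀).sub (hcont p₁)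
  have c6 : ContinuousWithinAt (fun s => H s p₁ - b₁) (Icc 0 l) 0 :=
    (hcont p₁).sub continuousWithinAt_const
  have c7 : ContinuousWithinAt
      (fun s => ((H s p₀ - H s p₁) / (p₁ - p₀) - κ) * (R - p₁)) (Icc 0 l) 0 :=
    (c4.sub continuousWithinAt_const).mul continuousWithinAt_const
  have e4 : ∀ᶠ s in nhdsWithin 0 (Icc 0 l), κ < (H s p₀ - H s p₁) / (p₁ - p₀) :=
    c4.tendsto.eventually_const_lt (by rw [← hκ₀]; linarith)
  have e5 : ∀ᶠ s in nhdsWithin 0 (Icc 0 l), H s p₀ - H s p₁ < H s p₁ - b₁ :=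
    c5.tendsto.eventually_lt c6.tendsto (by linarith)
  have e6 : ∀ᶠ s in nhdsWithin 0 (Icc 0 l),
      ((H s p₀ - H s p₁) / (p₁ - p₀) - κ) * (R - p₁) < H s p₁ - b₁ :=
    c7.tendsto.eventually_lt c6.tendsto (by rw [← hκ₀, hκ, hp₁]; linarith)
  have := e1.and (e2.and (e3.and (e4.and (e5.and e6))))
  rw [eventually_nhdsWithin_iff, Metric.eventually_nhds_iff] at this
  obtain ⟨ε, hε, hev⟩ := this
  refine ⟨κ, by linarith, p₁, by rw [hp₁, hη]; linarith, min ε l, ⟨lt_min hε hl, min_le_right _ _⟩,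
    fun s hs μ => ?_⟩
  have hsl : s ∈ Icc 0 l := ⟨hs.1.le, hs.2.le.trans (min_le_right _ _)⟩
  obtain ⟨f1, f2, f3, f4, f5, f6⟩ := hev (y := s) (by
    rw [Real.dist_eq, sub_zero, abs_of_pos hs.1]; exact hs.2.trans_le (min_le_left _ _)) hsl
  exact line_le_of_convex (h.convex s hsl) hlt0 hlt1 hqR (by linarith) f1 f2 f3.le f4.le
    (div_mul_cancel₀ _ (by linarith)).symm f5.le f6.le μ

/-! ### The modified Hamiltonian -/

section Modified

variable {Ht : ℝ → ℝ → ℝ} {a i₁ i₂ β₀ μ₀ : ℝ}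

lemma IsCutoff.slope_pos (hcut : IsCutoff Ht a i₁ i₂ β₀ μ₀) : 0 < β₀ := by
  obtain ⟨j₁, j₂, β, -, -, h0, h1, -⟩ := hcut.slope
  exact h0.trans_lt h1

lemma IsCutoff.linearTails_le (hcut : IsCutoff Ht a i₁ i₂ β₀ μ₀) {s : ℝ} (hs : s ∈ Icc 0 a)
    (ν : ℝ) : linearTails Ht β₀ μ₀ s ν ≤ Ht s ν := by
  unfold linearTails
  split_ifs with h1 h2
  · exact (hcut.left s hs ν h1).le
  · exact (hcut.right s hs ν h2).le
  · exact le_rfl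

lemma convexOn_vee {m β : ℝ} (hβ : 0 ≤ β) (c : ℝ) :
    ConvexOn ℝ univ (fun ν : ℝ => m + β * (|ν| - c)) := by
  refine ⟨convex_univ, fun x _ y _ p q hp hq hpq => ?_⟩
  simp only [smul_eq_mul]
  have h : |p * x + q * y| ≤ p * |x| + q * |y| :=
    (abs_add_le _ _).trans (by rw [abs_mul, abs_mul, abs_of_nonneg hp, abs_of_nonneg hq])
  have := mul_le_mul_of_nonneg_left h hβ
  have e : p = 1 - q := by linarith
  subst e
  linarith

/-- With `m` a lower bound of `Ht` on the compact part, the same vee works for all `s`. It supplies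
the convex minorant that the envelope needs, and the coercivity of the envelope. -/
lemma IsCutoff.exists_minorant (hcut : IsCutoff Ht a i₁ i₂ β₀ μ₀) (hHt : IsCoerciveH Ht a) :
    ∃ m, ∀ s ∈ Icc 0 a, ∀ ν, m + β₀ * (|ν| - μ₀) ≤ linearTails Ht β₀ μ₀ s ν := by
  have hK : IsCompact (Icc 0 a ×ˢ Icc (-μ₀) μ₀) := isCompact_Icc.prod isCompact_Icc
  obtain ⟨m, hm⟩ := hK.bddBelow_image (hHt.cont.mono (prod_mono_right (subset_univ _)))
  have hm' : ∀ s ∈ Icc 0 a, ∀ ν ∈ Icc (-μ₀) μ₀, m ≤ Ht s ν :=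
    fun s hs ν hν => hm ⟨(s, ν), ⟨hs, hν⟩, rfl⟩
  have hβ := hcut.slope_pos
  have hμ := hcut.pos
  refine ⟨m, fun s hs ν => ?_⟩
  unfold linearTails
  split_ifs with h1 h2
  · have := hm' s hs (-μ₀) ⟨le_rfl, by linarith⟩
    rw [abs_of_neg (by linarith)]
    linarith
  · have := hm' s hs μ₀ ⟨by linarith, le_rfl⟩
    rw [abs_of_pos (by linarith)]
    linarith
  · push Not at h1 h2
    have := hm' s hs ν ⟨h1, h2⟩
    have h3 : |ν| ≤ μ₀ := abs_le.2 ⟨h1, h2⟩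
    have := mul_nonneg hβ.le (sub_nonneg.2 h3)
    linarith

lemma modifiedH_le (hcut : IsCutoff Ht a i₁ i₂ β₀ μ₀) (hHt : IsCoerciveH Ht a) {s : ℝ}
    (hs : s ∈ Icc 0 a) (μ : ℝ) : modifiedH Ht β₀ μ₀ s μ ≤ Ht s μ := by
  obtain ⟨m, hm⟩ := hcut.exists_minorant hHt
  exact (convexEnvelope_le (convexOn_vee hcut.slope_pos.le μ₀) (hm s hs) μ).trans
    (hcut.linearTails_le hs μ)

/-- A supporting line of `Ht s` at a point of `(j₁, j₂)` has slope at most `β < β₀` in absolute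
value. It therefore stays below the linear tails too, and is a convex minorant touching `Ht s` at
that point. -/
lemma exists_modifiedH_eq (hcut : IsCutoff Ht a i₁ i₂ β₀ μ₀) (hHt : IsCoerciveH Ht a) :
    ∃ j₁ j₂, j₁ < i₁ ∧ i₂ < j₂ ∧ ∀ s ∈ Icc 0 a, ∀ μ ∈ Ioo j₁ j₂,
      modifiedH Ht β₀ μ₀ s μ = Ht s μ := by
  obtain ⟨j₁, j₂, β, hj₁, hj₂, hβ, hββ₀, hlip⟩ := hcut.slope
  refine ⟨j₁, j₂, hj₁, hj₂, fun s hs μ hμ => (modifiedH_le hcut hHt hs μ).antisymm ?_⟩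
  obtain ⟨p, hp⟩ := exists_support_line (hHt.convex s hs) μ
  have hp1 : p ≤ β := by
    have h := hlip s hs s hs j₂ ⟨by linarith [hμ.1, hμ.2], le_rfl⟩ μ ⟨hμ.1.le, hμ.2.le⟩
    rw [sub_self, abs_zero, zero_add, abs_of_pos (sub_pos.2 hμ.2)] at h
    exact le_of_mul_le_mul_right (by linarith [hp j₂, le_abs_self (Ht s j₂ - Ht s μ)])
      (sub_pos.2 hμ.2)
  have hp2 : -β ≤ p := by
    have h := hlip s hs s hs j₁ ⟨le_rfl, by linarith [hμ.1, hμ.2]⟩ μ ⟨hμ.1.le, hμ.2.le⟩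
    rw [sub_self, abs_zero, zero_add, abs_of_neg (sub_neg.2 hμ.1)] at h
    exact le_of_mul_le_mul_right (by linarith [hp j₁, le_abs_self (Ht s j₁ - Ht s μ)])
      (sub_pos.2 hμ.1)
  have hc : ConvexOn ℝ univ (fun ν : ℝ => Ht s μ + p * (ν - μ)) := by
    refine ⟨convex_univ, fun x _ y _ b c _ _ hbc => ?_⟩
    have e : b = 1 - c := by linarith
    subst e
    simp only [smul_eq_mul]
    exact le_of_eq (by ring)
  have := le_convexEnvelope (f := linearTails Ht β₀ μ₀ s) hc (fun ν => ?_) μ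
  · simpa [modifiedH] using this
  unfold linearTails
  split_ifs with h1 h2
  · have := hp (-μ₀)
    have := mul_nonneg (show 0 ≤ β₀ + p by linarith) (show 0 ≤ -μ₀ - ν by linarith)
    linarith
  · have := hp μ₀
    have := mul_nonneg (show 0 ≤ β₀ - p by linarith) (show 0 ≤ ν - μ₀ by linarith)
    linarith
  · exact hp ν

/-- The tails depend on `s` only through `Ht s (±μ₀)`, so uniform continuity of `Ht` on a compact
set gives continuity in `s` uniform over all momenta; continuity in the momentum comes from
convexity. -/
lemma isCoerciveH_modifiedH (hcut : IsCutoff Ht a i₁ i₂ β₀ μ₀) (hHt : IsCoerciveH Ht a) :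
    IsCoerciveH (modifiedH Ht β₀ μ₀) a := by
  obtain ⟨m, hm⟩ := hcut.exists_minorant hHt
  have hv := convexOn_vee (m := m) hcut.slope_pos.le μ₀
  have hconv : ∀ s ∈ Icc 0 a, ConvexOn ℝ univ (modifiedH Ht β₀ μ₀ s) :=
    fun s hs => convexOn_convexEnvelope hv (hm s hs)
  refine ⟨?_, hconv, fun C => ?_⟩
  · have hK : IsCompact (Icc 0 a ×ˢ Icc (-μ₀) μ₀) := isCompact_Icc.prod isCompact_Icc
    have huc := hK.uniformContinuousOn_of_continuous
      (hHt.cont.mono (prod_mono_right (subset_univ _)))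
    rw [Metric.uniformContinuousOn_iff] at huc
    rintro ⟨s₀, ν₀⟩ ⟨hs₀, -⟩
    rw [Metric.continuousWithinAt_iff]
    intro ε hε
    obtain ⟨δ, hδ, hδ'⟩ := huc (ε / 2) (by linarith)
    have hc : Continuous (modifiedH Ht β₀ μ₀ s₀) := by
      rw [← continuousOn_univ]
      exact (hconv s₀ hs₀).continuousOn isOpen_univ
    obtain ⟨δ', hδ'0, hδ''⟩ := Metric.continuous_iff.1 hc ν₀ (ε / 2) (by linarith)
    have key : ∀ s ∈ Icc 0 a, ∀ s' ∈ Icc 0 a, |s - s'| < δ → ∀ ν,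
        linearTails Ht β₀ μ₀ s ν ≤ linearTails Ht β₀ μ₀ s' ν + ε / 2 := by
      intro s hs s' hs' hss' ν
      have hμ := hcut.pos
      have h1 : ∀ q ∈ Icc (-μ₀) μ₀, Ht s q ≤ Ht s' q + ε / 2 := fun q hq => by
        have := hδ' (s, q) ⟨hs, hq⟩ (s', q) ⟨hs', hq⟩ (by
          exact max_lt (show |s - s'| < δ from hss') (by simpa using hδ))
        rw [Real.dist_eq] at this
        linarith [(abs_lt.1 this).2]
      unfold linearTails
      split_ifs with c1 c2
      · linarith [h1 (-μ₀) ⟨le_rfl, by linarith⟩]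
      · linarith [h1 μ₀ ⟨by linarith, le_rfl⟩]
      · push Not at c1 c2
        exact h1 ν ⟨c1, c2⟩
    refine ⟨min δ δ', lt_min hδ hδ'0, ?_⟩
    rintro ⟨s, ν⟩ ⟨hs, -⟩ hd
    rw [Prod.dist_eq, max_lt_iff, lt_min_iff, lt_min_iff] at hd
    have hd1 : |s - s₀| < δ := hd.1.1
    have h2 : dist (modifiedH Ht β₀ μ₀ s₀ ν) (modifiedH Ht β₀ μ₀ s₀ ν₀) < ε / 2 :=
      hδ'' ν hd.2.2
    rw [Real.dist_eq, abs_lt] at h2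
    have h3 : modifiedH Ht β₀ μ₀ s ν ≤ modifiedH Ht β₀ μ₀ s₀ ν + ε / 2 :=
      convexEnvelope_le_add hv (hm s hs) (key s hs s₀ hs₀ hd1) ν
    have h4 : modifiedH Ht β₀ μ₀ s₀ ν ≤ modifiedH Ht β₀ μ₀ s ν + ε / 2 :=
      convexEnvelope_le_add hv (hm s₀ hs₀) (key s₀ hs₀ s hs (by rwa [abs_sub_comm])) ν
    simp only [Real.dist_eq, abs_lt]
    constructor <;> linarith [h2.1, h2.2]
  · refine ⟨μ₀ + (C - m) / β₀, fun s hs μ hμ => ?_⟩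
    refine le_trans ?_ (le_convexEnvelope hv (hm s hs) μ)
    have hβ := hcut.slope_pos
    have : (C - m) / β₀ ≤ |μ| - μ₀ := by linarith
    rw [div_le_iff₀ hβ] at this
    linarith

/-- If `Ht > A` outside `[i₁,i₂]` and `Ht s` reaches a value at most `A`, then the modified
Hamiltonian exceeds `A` outside `[i₁,i₂]`. -/
lemma lt_modifiedH (hcut : IsCutoff Ht a i₁ i₂ β₀ μ₀) (hHt : IsCoerciveH Ht a) {A : ℝ}
    {s : ℝ} (hs : s ∈ Icc 0 a) (hA : ∀ μ, μ ∉ Icc i₁ i₂ → A < Ht s μ) (hq : ∃ q, Ht s q ≤ A)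
    {μ : ℝ} (hμ : μ ∉ Icc i₁ i₂) : A < modifiedH Ht β₀ μ₀ s μ := by
  obtain ⟨q, hq⟩ := hq
  have hqI : q ∈ Icc i₁ i₂ := by
    by_contra h
    exact absurd (hA q h) (not_lt.2 hq)
  obtain ⟨j₁, j₂, hj₁, hj₂, heq⟩ := exists_modifiedH_eq hcut hHt
  have hconv := (isCoerciveH_modifiedH hcut hHt).convex s hs
  have hHq : modifiedH Ht β₀ μ₀ s q ≤ A := (modifiedH_le hcut hHt hs q).trans hq
  rw [mem_Icc, not_and_or, not_le, not_le] at hμ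
  rcases hμ with hμ | hμ
  · rcases lt_or_ge j₁ μ with h | h
    · rw [heq s hs μ ⟨h, by linarith [hqI.1, hqI.2]⟩]
      exact hA μ fun h' => absurd h'.1 (not_le.2 hμ)
    -- Far from `I` the envelope may differ from `Ht`, but it exceeds `A` at `ν`, where both agree,
    -- and is at most `A` at `q`. Convexity makes it larger still on the far side of `ν`.
    set ν := (j₁ + i₁) / 2
    have hν1 : j₁ < ν := by simp only [ν]; linarith
    have hν2 : ν < i₁ := by simp only [ν]; linarith
    have hν : A < modifiedH Ht β₀ μ₀ s ν := by
      rw [heq s hs ν ⟨hν1, by linarith [hqI.1, hqI.2]⟩]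
      exact hA ν fun h' => absurd h'.1 (not_le.2 hν2)
    have hνq : ν < q := hν2.trans_le hqI.1
    have := convex_chord_left hconv (h.trans hν1.le) hνq
    have h5 : (modifiedH Ht β₀ μ₀ s ν - modifiedH Ht β₀ μ₀ s μ) * (q - ν) ≤ 0 * (q - ν) := by
      rw [zero_mul]
      exact this.trans (mul_nonpos_of_nonpos_of_nonneg (by linarith) (by linarith))
    linarith [le_of_mul_le_mul_right h5 (sub_pos.2 hνq)]
  · rcases lt_or_ge μ j₂ with h | h
    · rw [heq s hs μ ⟨by linarith [hqI.1, hqI.2], h⟩]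
      exact hA μ fun h' => absurd h'.2 (not_le.2 hμ)
    set ν := (j₂ + i₂) / 2
    have hν1 : ν < j₂ := by simp only [ν]; linarith
    have hν2 : i₂ < ν := by simp only [ν]; linarith
    have hν : A < modifiedH Ht β₀ μ₀ s ν := by
      rw [heq s hs ν ⟨by linarith [hqI.1, hqI.2], hν1⟩]
      exact hA ν fun h' => absurd h'.2 (not_le.2 hν2)
    have hqν : q < ν := hqI.2.trans_lt hν2
    have := convex_chord_right hconv hqν (hν1.le.trans h)
    have h5 : 0 * (ν - q) ≤ (modifiedH Ht β₀ μ₀ s μ - modifiedH Ht β₀ μ₀ s ν) * (ν - q) := by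
      rw [zero_mul]
      exact (mul_nonneg (by linarith) (by linarith)).trans this
    linarith [le_of_mul_le_mul_right h5 (sub_pos.2 hqν)]

end Modified

/-! ### Exponential penalizations and transport of subsolutions along lines -/

/-- Exponentials growing as fast as desired. -/
lemma exists_exp_large {r r' η : ℝ} (hr : r < r') (hη : 0 < η) (B : ℝ) :
    ∃ K > 0, ∀ x, r' ≤ x → B ≤ η * Real.exp (K * (x - r)) := by
  refine ⟨(|B| + 1) / (η * (r' - r)), by have := sub_pos.2 hr; positivity, fun x hx => ?_⟩
  have h1 := sub_pos.2 hr
  set K := (|B| + 1) / (η * (r' - r)) with hK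
  have hK0 : 0 < K := by positivity
  have h2 : K * (r' - r) ≤ K * (x - r) := by gcongr
  have h3 := Real.add_one_le_exp (K * (x - r))
  have h4 : η * (K * (r' - r)) = |B| + 1 := by
    rw [hK]; field_simp
  have h5 : η * (K * (r' - r)) ≤ η * Real.exp (K * (x - r)) := by gcongr; linarith
  linarith [le_abs_self B]

/-- Along lines of slope `w`, subsolutions grow at most at the rate `ℓ` if `H s q ≥ w q - ℓ`. -/
lemma IsViscSub.transport {H : ℝ → ℝ → ℝ} {l T : ℝ} {U : ℝ × ℝ → ℝ}
    (hU : ContinuousOn U (Icc 0 l ×ˢ Icc 0 T)) (hsub : IsViscSub H l T U) {σ w ℓ : ℝ} (hσ : σ ≤ l)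
    (hline : ∀ s ∈ Ioo 0 σ, ∀ q, w * q - ℓ ≤ H s q) {s t r : ℝ} (hr : 0 < r)
    (hs : s ∈ Ioo 0 σ) (hs' : s + w * r ∈ Ioo 0 σ) (ht : 0 < t) (ht' : t + r < T) :
    U (s + w * r, t + r) ≤ U (s, t) + ℓ * r := by
  by_contra! hlt
  set α := U (s + w * r, t + r) - U (s, t) - ℓ * r with hα
  have hα0 : 0 < α := by linarith
  -- a slightly longer segment, and a strip around it
  obtain ⟨r', hrr', hr'T, hr'σ⟩ : ∃ r', r < r' ∧ t + r' < T ∧ s + w * r' ∈ Ioo 0 σ := by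
    have e1 : ∀ᶠ x in nhds r, t + x < T := by
      have : Continuous fun x : ℝ => t + x := by fun_prop
      exact this.continuousAt.eventually_lt continuousAt_const ht'
    have e2 : ∀ᶠ x in nhds r, s + w * x ∈ Ioo 0 σ := by
      have : Continuous fun x : ℝ => s + w * x := by fun_prop
      exact this.continuousAt.eventually_mem (isOpen_Ioo.mem_nhds hs')
    obtain ⟨r', h1, h2⟩ := (((e1.and e2).filter_mono nhdsWithin_le_nhds).and
      (self_mem_nhdsWithin (s := Ioi r))).exists
    exact ⟨r', h2, h1.1, h1.2⟩
  have hr'0 : 0 < r' := hr.trans hrr'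
  have hseg : ∀ x ∈ Icc 0 r', s + w * x ∈ Ioo (min s (s + w * r') / 2) σ ∧
      min s (s + w * r') ≤ s + w * x ∧ s + w * x ≤ max s (s + w * r') := by
    intro x hx
    have : min s (s + w * r') ≤ s + w * x ∧ s + w * x ≤ max s (s + w * r') := by
      rcases le_total 0 w with hw | hw
      · have h1 := mul_le_mul_of_nonneg_left hx.2 hw
        have h2 := mul_nonneg hw hx.1
        exact ⟨(min_le_left _ _).trans (by linarith), le_trans (by linarith) (le_max_right _ _)⟩
      · have h1 := mul_le_mul_of_nonpos_left hx.2 hw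
        have h2 := mul_nonpos_of_nonpos_of_nonneg hw hx.1
        exact ⟨(min_le_right _ _).trans (by linarith), le_trans (by linarith) (le_max_left _ _)⟩
    have h3 : 0 < min s (s + w * r') := lt_min hs.1 hr'σ.1
    exact ⟨⟨by linarith, this.2.trans_lt (max_lt hs.2 hr'σ.2)⟩, this⟩
  have hm0 : 0 < min s (s + w * r') := lt_min hs.1 hr'σ.1
  have hM0 : max s (s + w * r') < σ := max_lt hs.2 hr'σ.2
  have hst : (s, t) ∈ Icc 0 l ×ˢ Icc 0 T :=
    ⟨⟨hs.1.le, hs.2.le.trans hσ⟩, ⟨ht.le, by linarith⟩⟩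
  obtain ⟨δ₀, hδ₀, hδ₀'⟩ := Metric.continuousWithinAt_iff.1 (hU (s, t) hst) (α / 2) (by linarith)
  set δ := min (δ₀ / 2) (min (min s (s + w * r') / 2) ((σ - max s (s + w * r')) / 2)) with hδ
  have hδ0 : 0 < δ := lt_min (by linarith) (lt_min (by linarith) (by linarith))
  have hδ1 : δ < δ₀ := (min_le_left _ _).trans_lt (by linarith)
  have hδ2 : δ < min s (s + w * r') :=
    ((min_le_right _ _).trans (min_le_left _ _)).trans_lt (by linarith)
  have hδ3 : δ < σ - max s (s + w * r') :=
    ((min_le_right _ _).trans (min_le_right _ _)).trans_lt (by linarith)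
  have hin : ∀ x ∈ Icc 0 r', ∀ z ∈ Icc (-δ) δ, s + w * x + z ∈ Ioo 0 σ := fun x hx z hz =>
    ⟨by linarith [(hseg x hx).2.1, hz.1], by linarith [(hseg x hx).2.2, hz.2]⟩
  have hin' : ∀ x ∈ Icc 0 r', ∀ z ∈ Icc (-δ) δ,
      (s + w * x + z, t + x) ∈ Icc 0 l ×ˢ Icc 0 T := fun x hx z hz =>
    ⟨⟨(hin x hx z hz).1.le, (hin x hx z hz).2.le.trans hσ⟩,
      ⟨by linarith [hx.1], by linarith [hx.2]⟩⟩
  obtain ⟨B, hB⟩ := (isCompact_Icc.prod isCompact_Icc).exists_bound_of_continuousOn hU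
  have hB' : ∀ x ∈ Icc 0 r', ∀ z ∈ Icc (-δ) δ, |U (s + w * x + z, t + x)| ≤ B :=
    fun x hx z hz => hB _ (hin' x hx z hz)
  have hBs : |U (s, t)| ≤ B := hB _ hst
  -- With this `η`, `F (r, 0) = U (s, t) + 3 * α / 4`, whereas on the side `x = 0` of the strip
  -- continuity allows less than `U (s, t) + α / 2`.
  set η := α / 4 with hη
  -- The constant dominates every possible gain of `U - ℓ x`; the exponential thus keeps the maximum
  -- away from `x = r'`, and the quadratic term away from `|z| = δ`.
  obtain ⟨K, hK0, hK⟩ := exists_exp_large (r := r) (r' := r') hrr' (η := η) (by linarith)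
    (2 * B + |ℓ| * r' + 1)
  set C := (2 * B + |ℓ| * r' + 1) / δ ^ 2 with hC
  have hCδ : C * δ ^ 2 = 2 * B + |ℓ| * r' + 1 := by rw [hC]; field_simp
  have hC0 : 0 ≤ C := by
    have : 0 ≤ B := (abs_nonneg _).trans hBs
    positivity
  set F : ℝ × ℝ → ℝ := fun p => U (s + w * p.1 + p.2, t + p.1) - ℓ * p.1
    - η * Real.exp (K * (p.1 - r)) - C * p.2 ^ 2 with hF
  have hFc : ContinuousOn F (Icc 0 r' ×ˢ Icc (-δ) δ) := by
    have : ContinuousOn (fun p : ℝ × ℝ => U (s + w * p.1 + p.2, t + p.1))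
        (Icc 0 r' ×ˢ Icc (-δ) δ) :=
      hU.comp (f := fun p : ℝ × ℝ => (s + w * p.1 + p.2, t + p.1)) (by fun_prop)
        (fun p hp => hin' p.1 hp.1 p.2 hp.2)
    have h2 : Continuous (fun p : ℝ × ℝ => ℓ * p.1) := by fun_prop
    have h3 : Continuous (fun p : ℝ × ℝ => η * Real.exp (K * (p.1 - r))) := by fun_prop
    have h4 : Continuous (fun p : ℝ × ℝ => C * p.2 ^ 2) := by fun_prop
    exact ((this.sub h2.continuousOn).sub h3.continuousOn).sub h4.continuousOn
  obtain ⟨⟨x₀, z₀⟩, ⟨hx₀, hz₀⟩, hmax⟩ := (isCompact_Icc.prod isCompact_Icc).exists_isMaxOn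
    (⟨(0, 0), ⟨⟨le_rfl, hr'0.le⟩, ⟨by linarith, hδ0.le⟩⟩⟩) hFc
  have hval : U (s, t) + α - η ≤ F (x₀, z₀) := by
    have : F (r, 0) ≤ F (x₀, z₀) := hmax (show ((r, 0) : ℝ × ℝ) ∈ _ from
      ⟨⟨hr.le, hrr'.le⟩, ⟨by linarith, hδ0.le⟩⟩)
    refine le_trans (le_of_eq ?_) this
    simp only [hF, hα]
    simp
    ring
  have hFval : F (x₀, z₀) = U (s + w * x₀ + z₀, t + x₀) - ℓ * x₀
    - η * Real.exp (K * (x₀ - r)) - C * z₀ ^ 2 := rfl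
  have hexp : 0 < η * Real.exp (K * (x₀ - r)) := by
    have : 0 < η := by linarith
    positivity
  have hCz : 0 ≤ C * z₀ ^ 2 := by positivity
  have hUb := abs_le.1 (hB' x₀ hx₀ z₀ hz₀)
  have hℓ : -(ℓ * x₀) ≤ |ℓ| * r' := by
    have h1 : |ℓ * x₀| ≤ |ℓ| * r' := by
      rw [abs_mul, abs_of_nonneg hx₀.1]; exact mul_le_mul_of_nonneg_left hx₀.2 (abs_nonneg _)
    linarith [neg_abs_le (ℓ * x₀)]
  have hUs := abs_le.1 hBs
  have hx₀' : x₀ < r' := by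
    by_contra! h
    linarith [hK x₀ h]
  have hz₀' : |z₀| < δ := by
    by_contra! h
    have : δ ^ 2 ≤ z₀ ^ 2 := by
      rw [← sq_abs z₀]; exact pow_le_pow_left₀ hδ0.le h 2
    have := mul_le_mul_of_nonneg_left this hC0
    linarith
  have hx₀0 : 0 < x₀ := by
    rcases (show (0 : ℝ) ≤ x₀ from hx₀.1).eq_or_lt with h | h
    · exfalso
      subst h
      have hd := hδ₀' (x := (s + z₀, t)) (by
          have := hin' 0 ⟨le_rfl, hr'0.le⟩ z₀ hz₀
          simpa using this) (by
        rw [Prod.dist_eq]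
        refine max_lt ?_ (by simpa using hδ₀)
        rw [Real.dist_eq, add_sub_cancel_left]
        exact hz₀'.trans hδ1)
      rw [Real.dist_eq] at hd
      have hd' := (abs_lt.1 hd).2
      simp only [mul_zero, add_zero] at hFval
      rw [hFval] at hval
      linarith
    · exact h
  -- the test function
  set φ : ℝ × ℝ → ℝ := fun p => ℓ * (p.2 - t) + η * Real.exp (K * (p.2 - t - r))
    + C * (p.1 - s - w * (p.2 - t)) ^ 2 with hφ
  have hφc : ContDiff ℝ 1 φ := by fun_prop
  have hloc : IsLocalMax (fun p => U p - φ p) (s + w * x₀ + z₀, t + x₀) := by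
    have hcont : Continuous fun p : ℝ × ℝ => (p.2 - t, p.1 - s - w * (p.2 - t)) := by fun_prop
    have hmem : ∀ᶠ p in nhds (s + w * x₀ + z₀, t + x₀),
        (p.2 - t, p.1 - s - w * (p.2 - t)) ∈ Ioo 0 r' ×ˢ Ioo (-δ) δ := by
      refine hcont.continuousAt.eventually_mem ((isOpen_Ioo.prod isOpen_Ioo).mem_nhds ?_)
      have e1 : t + x₀ - t = x₀ := by ring
      have e2 : s + w * x₀ + z₀ - s - w * x₀ = z₀ := by ring
      simp only [e1, e2]
      exact ⟨⟨hx₀0, hx₀'⟩, abs_lt.1 hz₀'⟩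
    filter_upwards [hmem] with p hp
    have h := hmax (show ((p.2 - t, p.1 - s - w * (p.2 - t)) : ℝ × ℝ) ∈ _ from
      ⟨Ioo_subset_Icc_self hp.1, Ioo_subset_Icc_self hp.2⟩)
    simp only [hF, mem_ofPred_eq] at h
    have e1 : s + w * (p.2 - t) + (p.1 - s - w * (p.2 - t)) = p.1 := by ring
    have e2 : t + (p.2 - t) = p.2 := by ring
    rw [e1, e2] at h
    simp only [hφ]
    have e3 : t + x₀ - t = x₀ := by ring
    have e4 : s + w * x₀ + z₀ - s - w * x₀ = z₀ := by ring
    rw [e3, e4]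
    linarith
  have hres := hsub _ ⟨(hin x₀ hx₀ z₀ hz₀).1, (hin x₀ hx₀ z₀ hz₀).2.trans_le hσ⟩ _
    (⟨by linarith, by linarith⟩ : t + x₀ ∈ Ioo 0 T) φ hφc hloc
  have e3 : t + x₀ - t = x₀ := by ring
  have hd1 : HasDerivAt (fun τ => φ (s + w * x₀ + z₀, τ))
      (ℓ + η * (Real.exp (K * (x₀ - r)) * K) + C * (2 * z₀ * (-w))) (t + x₀) := by
    have h1 : HasDerivAt (fun τ : ℝ => τ - t) 1 (t + x₀) := (hasDerivAt_id _).sub_const t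
    have h2 := ((h1.sub_const r).const_mul K).exp.const_mul η
    have h3 := (((h1.const_mul w).const_sub (s + w * x₀ + z₀ - s)).pow 2).const_mul C
    refine (((h1.const_mul ℓ).add h2).add h3).congr_deriv ?_
    simp only [e3]
    push_cast
    ring
  have hd2 : HasDerivAt (fun σ => φ (σ, t + x₀)) (C * (2 * z₀)) (s + w * x₀ + z₀) := by
    have h1 : HasDerivAt (fun σ : ℝ => σ - s - w * (t + x₀ - t)) 1 (s + w * x₀ + z₀) :=
      ((hasDerivAt_id _).sub_const s).sub_const _
    have h3 := (h1.pow 2).const_mul C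
    refine (h3.const_add (ℓ * (t + x₀ - t) + η * Real.exp (K * (t + x₀ - t - r)))).congr_deriv ?_
    simp only [e3]
    push_cast
    ring
  rw [residual, hd1.deriv, hd2.deriv] at hres
  -- The test function moves with speed `w`, so the terms in `w * z₀` and `ℓ` cancel against the
  -- line, leaving the positive derivative of the exponential.
  have := hline _ (hin x₀ hx₀ z₀ hz₀) (C * (2 * z₀))
  have h5 : 0 < η * (Real.exp (K * (x₀ - r)) * K) := by
    have : 0 < η := by linarith
    positivity
  linarith

/-- Transport up to the initial point of the segment. -/
lemma IsViscSub.transport_to_zero {H : ℝ → ℝ → ℝ} {l T : ℝ} {U : ℝ × ℝ → ℝ}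
    (hU : ContinuousOn U (Icc 0 l ×ˢ Icc 0 T)) (hsub : IsViscSub H l T U) {σ κ ℓ : ℝ} (hσ : σ ≤ l)
    (hκ : 0 < κ) (hline : ∀ s ∈ Ioo 0 σ, ∀ q, -κ * q - ℓ ≤ H s q) {s t : ℝ}
    (hs : s ∈ Ioo 0 σ) (ht : t < T) (ht' : 0 < t - s / κ) :
    U (0, t) ≤ U (s, t - s / κ) + ℓ * (s / κ) := by
  have hsκ : 0 < s / κ := div_pos hs.1 hκ
  have hmem : ∀ r ∈ Icc 0 (s / κ), (s + -κ * r, t - s / κ + r) ∈ Icc 0 l ×ˢ Icc 0 T := by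
    intro r hr
    have h1 : κ * r ≤ s := by
      have := mul_le_mul_of_nonneg_left hr.2 hκ.le
      rwa [mul_div_cancel₀ _ hκ.ne'] at this
    have h2 : 0 ≤ κ * r := mul_nonneg hκ.le hr.1
    exact ⟨⟨by linarith, by linarith [hs.2]⟩, ⟨by linarith [hr.1], by linarith [hr.2]⟩⟩
  have hc : ContinuousOn (fun r => U (s + -κ * r, t - s / κ + r)) (Icc 0 (s / κ)) :=
    hU.comp (f := fun r : ℝ => (s + -κ * r, t - s / κ + r)) (by fun_prop) hmem
  have hc' : ContinuousOn (fun r => U (s, t - s / κ) + ℓ * r) (Icc 0 (s / κ)) := by fun_prop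
  have hcl : closure (Ioo 0 (s / κ)) = Icc 0 (s / κ) := closure_Ioo hsκ.ne
  have h0 : s / κ ∈ closure (Ioo 0 (s / κ)) := by rw [hcl]; exact ⟨hsκ.le, le_rfl⟩
  rw [← hcl] at hc hc'
  -- `transport` needs both ends of the segment in the open interval; the endpoint `0` is reached by
  -- continuity as `r` tends to `s / κ`.
  have := le_on_closure (fun r hr => ?_) hc hc' h0
  · have e1 : s + -κ * (s / κ) = 0 := by field_simp; ring
    have e2 : t - s / κ + s / κ = t := by ring
    rwa [e1, e2] at this
  · have h1 : κ * r < s := by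
      have := mul_lt_mul_of_pos_left hr.2 hκ
      rwa [mul_div_cancel₀ _ hκ.ne'] at this
    have h2 : 0 < κ * r := mul_pos hκ hr.1
    exact hsub.transport hU hσ hline hr.1 hs ⟨by linarith, by linarith [hs.2]⟩ ht'
      (by linarith [hr.2])

/-! ### Contact points at the endpoints of an arc -/

/-- If the doubled difference of `U` and `V` attains its maximum at the endpoint `0`, then a
subtangent to `V`, with negative residual, exists there. -/
lemma exists_subtangent_left {H : ℝ → ℝ → ℝ} {l T k t₀ τ₀ : ℝ} {U V : ℝ × ℝ → ℝ} {θ : ℝ → ℝ}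
    (hl : 0 < l) (hH : IsCoerciveH H l) (hU : ContinuousOn U (Icc 0 l ×ˢ Icc 0 T))
    (hsub : IsViscSub H l T U) (hθ : ContDiff ℝ 1 θ) (ht₀ : t₀ ∈ Ioo 0 T)
    (hmax : ∀ s ∈ Icc 0 l, ∀ t ∈ Icc 0 T, ∀ τ ∈ Icc 0 T,
      U (s, t) - V (s, τ) - k * (t - τ) ^ 2 - θ t
        ≤ U (0, t₀) - V (0, τ₀) - k * (t₀ - τ₀) ^ 2 - θ t₀)
    (hθ' : 0 < deriv θ t₀) (hq : ∃ q, H 0 q ≤ -(2 * k * (t₀ - τ₀)) - deriv θ t₀) :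
    ∃ φ : ℝ × ℝ → ℝ, ContDiff ℝ 1 φ ∧
      IsLocalMinOn (fun p => V p - φ p) (Icc 0 l ×ˢ Icc 0 T) (0, τ₀) ∧ residual H φ 0 τ₀ < 0 := by
  -- The term `deriv θ t₀ > 0` is the room between the height of the line and the level `-2k(t₀ -
  -- τ₀)` that `H 0 p` must stay below.
  obtain ⟨κ, hκ, p, hp, σ, hσ, hline⟩ := hH.exists_line hl
    (show -(2 * k * (t₀ - τ₀)) - deriv θ t₀ < -(2 * k * (t₀ - τ₀)) by linarith) hq
  set a := 2 * k * (t₀ - τ₀) with ha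
  set ℓ := a + deriv θ t₀ - κ * p with hℓ
  have htr : ∀ s ∈ Ico 0 σ, s / κ < t₀ → U (0, t₀) ≤ U (s, t₀ - s / κ) + ℓ * (s / κ) := by
    intro s hs hst
    rcases hs.1.eq_or_lt with h | h
    · subst h; simp
    · exact hsub.transport_to_zero hU hσ.2 hκ (fun s hs q => by linarith [hline s hs q])
        ⟨h, hs.2⟩ ht₀.2 (by linarith)
  have hc : ContDiff ℝ 1 (fun p : ℝ × ℝ => t₀ - p.1 / κ) := by fun_prop
  -- Taking `t = t₀ - s / κ` in `hmax` and bounding `U` there from below by `htr` leaves this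
  -- function below `V` up to a constant. Its derivatives at `(0, τ₀)` are `a` in time and, by the
  -- choice of `ℓ`, `p` in space.
  refine ⟨fun p => -ℓ * (p.1 / κ) - θ (t₀ - p.1 / κ) - k * (t₀ - p.1 / κ - p.2) ^ 2, ?_, ?_, ?_⟩
  · exact ((by fun_prop : ContDiff ℝ 1 (fun p : ℝ × ℝ => -ℓ * (p.1 / κ))).sub (hθ.comp hc)).sub
      (by fun_prop)
  · have hc1 : Continuous (fun p : ℝ × ℝ => p.1) := continuous_fst
    have hc2 : Continuous (fun p : ℝ × ℝ => p.1 / κ) := by fun_prop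
    have e1 : ∀ᶠ p : ℝ × ℝ in nhds (0, τ₀), p.1 < σ :=
      hc1.continuousAt.eventually_lt continuousAt_const hσ.1
    have e2 : ∀ᶠ p : ℝ × ℝ in nhds (0, τ₀), p.1 / κ < t₀ :=
      hc2.continuousAt.eventually_lt continuousAt_const (by simpa using ht₀.1)
    filter_upwards [e1.filter_mono nhdsWithin_le_nhds, e2.filter_mono nhdsWithin_le_nhds,
      self_mem_nhdsWithin] with ⟨s, τ⟩ h1 h2 h3
    have h0 : 0 ≤ s / κ := div_nonneg h3.1.1 hκ.le
    have h4 := hmax s h3.1 (t₀ - s / κ) ⟨by linarith, by linarith [ht₀.2]⟩ τ h3.2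
    have h5 := htr s ⟨h3.1.1, h1⟩ h2
    simp only [zero_div, sub_zero, mul_zero]
    linarith
  · have hd1 : HasDerivAt (fun τ => -ℓ * (0 / κ) - θ (t₀ - 0 / κ) - k * (t₀ - 0 / κ - τ) ^ 2)
        a τ₀ := by
      have h1 := ((((hasDerivAt_id τ₀).const_sub (t₀ - 0 / κ)).pow 2).const_mul k).const_sub
        (-ℓ * (0 / κ) - θ (t₀ - 0 / κ))
      refine h1.congr_deriv ?_
      simp [ha]
      ring
    have hd2 : HasDerivAt (fun s => -ℓ * (s / κ) - θ (t₀ - s / κ) - k * (t₀ - s / κ - τ₀) ^ 2)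
        p 0 := by
      have h1 : HasDerivAt (fun s : ℝ => s / κ) (1 / κ) 0 := (hasDerivAt_id _).div_const κ
      have h2 := h1.const_sub t₀
      have hθd : HasDerivAt θ (deriv θ t₀) (t₀ - 0 / κ) := by
        rw [zero_div, sub_zero]
        exact (hθ.differentiable one_ne_zero t₀).hasDerivAt
      have h3 := HasDerivAt.comp (0 : ℝ) hθd h2
      have h4 := ((h2.sub_const τ₀).pow 2).const_mul k
      refine (((h1.const_mul (-ℓ)).sub h3).sub h4).congr_deriv ?_
      have e : κ * κ⁻¹ = 1 := mul_inv_cancel₀ hκ.ne'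
      simp only [one_div, zero_div, sub_zero, hℓ, ha]
      push_cast
      linear_combination p * e
    rw [residual, hd1.deriv, hd2.deriv]
    linarith

lemma residual_reflect (H : ℝ → ℝ → ℝ) (φ : ℝ × ℝ → ℝ) (l s t : ℝ) :
    residual (fun s μ => H (l - s) (-μ)) (fun p => φ (l - p.1, p.2)) s t
      = residual H φ (l - s) t := by
  simp only [residual]
  rw [deriv_comp_const_sub (f := fun σ => φ (σ, t)), neg_neg]

lemma IsViscSub.reflect {H : ℝ → ℝ → ℝ} {l T : ℝ} {U : ℝ × ℝ → ℝ} (h : IsViscSub H l T U) :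
    IsViscSub (fun s μ => H (l - s) (-μ)) l T (fun p => U (l - p.1, p.2)) := by
  intro s hs t ht φ hφ hmax
  have h1 : ContDiff ℝ 1 (fun p : ℝ × ℝ => φ (l - p.1, p.2)) :=
    hφ.comp (by fun_prop : ContDiff ℝ 1 (fun p : ℝ × ℝ => (l - p.1, p.2)))
  have hg : ContinuousAt (fun p : ℝ × ℝ => (l - p.1, p.2)) (l - s, t) := by fun_prop
  have e : (l - (l - s), t) = (s, t) := by simp
  have h2 : IsLocalMax (fun p : ℝ × ℝ => U p - φ (l - p.1, p.2)) (l - s, t) := by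
    have h2 : Filter.Tendsto (fun p : ℝ × ℝ => (l - p.1, p.2)) (nhds (l - s, t))
        (nhds (l - (l - s), t)) := hg.tendsto
    rw [e] at h2
    filter_upwards [h2.eventually hmax] with p hp
    simpa using hp
  have h3 := h (l - s) ⟨by linarith [hs.2], by linarith [hs.1]⟩ t ht _ h1 h2
  have e' := residual_reflect H (fun p => φ (l - p.1, p.2)) l s t
  simp only [sub_sub_cancel, Prod.mk.eta] at e'
  rw [e']
  exact h3

/-- The reflection `s ↦ l - s`, with `μ ↦ -μ`, reduces this to the left endpoint. -/
lemma exists_subtangent_right {H : ℝ → ℝ → ℝ} {l T k t₀ τ₀ : ℝ} {U V : ℝ × ℝ → ℝ} {θ : ℝ → ℝ}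
    (hl : 0 < l) (hH : IsCoerciveH H l) (hU : ContinuousOn U (Icc 0 l ×ˢ Icc 0 T))
    (hsub : IsViscSub H l T U) (hθ : ContDiff ℝ 1 θ) (ht₀ : t₀ ∈ Ioo 0 T)
    (hmax : ∀ s ∈ Icc 0 l, ∀ t ∈ Icc 0 T, ∀ τ ∈ Icc 0 T,
      U (s, t) - V (s, τ) - k * (t - τ) ^ 2 - θ t
        ≤ U (l, t₀) - V (l, τ₀) - k * (t₀ - τ₀) ^ 2 - θ t₀)
    (hθ' : 0 < deriv θ t₀) (hq : ∃ q, H l q ≤ -(2 * k * (t₀ - τ₀)) - deriv θ t₀) :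
    ∃ φ : ℝ × ℝ → ℝ, ContDiff ℝ 1 φ ∧
      IsLocalMinOn (fun p => V p - φ p) (Icc 0 l ×ˢ Icc 0 T) (l, τ₀) ∧ residual H φ l τ₀ < 0 := by
  have hmaps : MapsTo (fun p : ℝ × ℝ => (l - p.1, p.2)) (Icc 0 l ×ˢ Icc 0 T)
      (Icc 0 l ×ˢ Icc 0 T) := by
    rintro ⟨s, t⟩ ⟨h1, h2⟩
    exact ⟨⟨by linarith [h1.2], by linarith [h1.1]⟩, h2⟩
  obtain ⟨φ, hφ, hmin, hres⟩ := exists_subtangent_left (V := fun p => V (l - p.1, p.2))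
    (k := k) (τ₀ := τ₀) hl hH.reflect
    (hU.comp (f := fun p : ℝ × ℝ => (l - p.1, p.2)) (by fun_prop) hmaps) hsub.reflect hθ ht₀
    (fun s hs t ht τ hτ => by
      simpa using hmax (l - s) ⟨by linarith [hs.2], by linarith [hs.1]⟩ t ht τ hτ) hθ'
    (by obtain ⟨q, hq⟩ := hq; exact ⟨-q, by simpa using hq⟩)
  have hg : Continuous (fun p : ℝ × ℝ => (l - p.1, p.2)) := by fun_prop
  refine ⟨fun p => φ (l - p.1, p.2), hφ.comp
    (by fun_prop : ContDiff ℝ 1 (fun p : ℝ × ℝ => (l - p.1, p.2))), ?_, ?_⟩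
  · have ht : Filter.Tendsto (fun p : ℝ × ℝ => (l - p.1, p.2))
        (nhdsWithin (l, τ₀) (Icc 0 l ×ˢ Icc 0 T)) (nhdsWithin (0, τ₀) (Icc 0 l ×ˢ Icc 0 T)) := by
      have := (hg.continuousWithinAt (s := Icc 0 l ×ˢ Icc 0 T)
        (x := (l, τ₀))).tendsto_nhdsWithin hmaps
      simpa using this
    filter_upwards [ht.eventually hmin] with p hp
    simpa using hp
  · have e := residual_reflect H (fun p => φ (l - p.1, p.2)) l 0 τ₀
    simp only [sub_zero, sub_sub_cancel, Prod.mk.eta] at e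
    rw [← e]
    exact hres

/-! ### Doubling the space variable in the interior of an arc -/

/-- Penalization: maximizers of `F - n G` accumulate, as `n → ∞`, at a maximizer of `F` on
`{G = 0}`. -/
lemma exists_penalized_max {X : Type*} [MetricSpace X] {Q : Set X} (hQ : IsCompact Q) {F G : X → ℝ}
    (hF : ContinuousOn F Q) (hG : ContinuousOn G Q) (hG0 : ∀ x ∈ Q, 0 ≤ G x)
    (hne : ∃ y ∈ Q, G y = 0) :
    ∃ x ∈ Q, G x = 0 ∧ (∀ y ∈ Q, G y = 0 → F y ≤ F x) ∧ ∀ W ∈ nhds x, ∃ n : ℕ, ∃ z ∈ Q, z ∈ W ∧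
      ∀ y ∈ Q, F y - n * G y ≤ F z - n * G z := by
  obtain ⟨y₀, hy₀, hy₀'⟩ := hne
  have hmax : ∀ n : ℕ, ∃ z ∈ Q, ∀ y ∈ Q, F y - n * G y ≤ F z - n * G z := fun n =>
    hQ.exists_isMaxOn ⟨y₀, hy₀⟩ (hF.sub (continuousOn_const.mul hG))
  choose z hzQ hz using hmax
  obtain ⟨x, hx, ψ, hψ, hlim⟩ := hQ.tendsto_subseq hzQ
  have hlim' : Filter.Tendsto (z ∘ ψ) Filter.atTop (nhdsWithin x Q) :=
    tendsto_nhdsWithin_iff.2 ⟨hlim, Filter.Eventually.of_forall fun n => hzQ _⟩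
  have hFl := (hF x hx).tendsto.comp hlim'
  have hGl := (hG x hx).tendsto.comp hlim'
  obtain ⟨B, hB⟩ := hQ.exists_bound_of_continuousOn hF
  have hbd : ∀ n : ℕ, 0 < n → G (z n) ≤ 2 * B / n := fun n hn => by
    have h1 := hz n y₀ hy₀
    have h2 := abs_le.1 (hB _ hy₀)
    have h3 := abs_le.1 (hB _ (hzQ n))
    have hn' : (0 : ℝ) < n := by exact_mod_cast hn
    rw [le_div_iff₀ hn']
    rw [hy₀', mul_zero] at h1
    linarith
  have hGx : G x = 0 := by
    refine le_antisymm ?_ (hG0 x hx)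
    have h1 : Filter.Tendsto (fun n => 2 * B / (ψ n : ℝ)) Filter.atTop (nhds 0) :=
      ((tendsto_const_div_atTop_nhds_zero_nat (2 * B)).comp hψ.tendsto_atTop)
    refine le_of_tendsto_of_tendsto hGl h1 ?_
    filter_upwards [hψ.tendsto_atTop.eventually_gt_atTop 0] with n hn
    exact hbd _ hn
  refine ⟨x, hx, hGx, fun y hy hGy => ?_, fun W hW => ?_⟩
  · refine ge_of_tendsto hFl (Filter.Eventually.of_forall fun n => ?_)
    have h1 := hz (ψ n) y hy
    have h2 := mul_nonneg (Nat.cast_nonneg (α := ℝ) (ψ n)) (hG0 _ (hzQ (ψ n)))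
    rw [hGy, mul_zero] at h1
    simp only [Function.comp_apply]
    linarith
  · obtain ⟨n, hn⟩ := (hlim.eventually hW).exists
    exact ⟨ψ n, z (ψ n), hzQ _, hn, hz _⟩

/-- The maximum of the doubled difference of a subsolution and a supersolution on an arc cannot be
attained only at interior points. -/
lemma false_of_interior_max {H : ℝ → ℝ → ℝ} {l T k lam : ℝ} {U V : ℝ × ℝ → ℝ} {θ : ℝ → ℝ}
    (hl : 0 < l) (hT : 0 < T) (hk : 0 ≤ k) (hH : IsCoerciveH H l)
    (hU : ContinuousOn U (Icc 0 l ×ˢ Icc 0 T)) (hV : ContinuousOn V (Icc 0 l ×ˢ Icc 0 T))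
    (hsub : IsViscSub H l T U) (hsup : IsViscSuper H l T V) (hθ : ContDiff ℝ 1 θ)
    (hlam : 0 < lam) (hθ' : ∀ t ∈ Icc 0 T, lam ≤ deriv θ t)
    (hint : ∀ s₀ ∈ Icc 0 l, ∀ t₀ ∈ Icc 0 T, ∀ τ₀ ∈ Icc 0 T,
      (∀ s ∈ Icc 0 l, ∀ t ∈ Icc 0 T, ∀ τ ∈ Icc 0 T,
        U (s, t) - V (s, τ) - k * (t - τ) ^ 2 - θ t
          ≤ U (s₀, t₀) - V (s₀, τ₀) - k * (t₀ - τ₀) ^ 2 - θ t₀) →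
      s₀ ∈ Ioo 0 l ∧ t₀ ∈ Ioo 0 T ∧ τ₀ ∈ Ioo 0 T) : False := by
  set Q : Set ((ℝ × ℝ) × (ℝ × ℝ)) := (Icc 0 l ×ˢ Icc 0 l) ×ˢ (Icc 0 T ×ˢ Icc 0 T) with hQdef
  have hQ : IsCompact Q := (isCompact_Icc.prod isCompact_Icc).prod (isCompact_Icc.prod isCompact_Icc)
  set F : (ℝ × ℝ) × (ℝ × ℝ) → ℝ := fun p =>
    U (p.1.1, p.2.1) - V (p.1.2, p.2.2) - k * (p.2.1 - p.2.2) ^ 2 - θ p.2.1 with hF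
  set G : (ℝ × ℝ) × (ℝ × ℝ) → ℝ := fun p => (p.1.1 - p.1.2) ^ 2 with hG
  have hFc : ContinuousOn F Q := by
    have h1 : ContinuousOn (fun p : (ℝ × ℝ) × (ℝ × ℝ) => U (p.1.1, p.2.1)) Q :=
      hU.comp (f := fun p : (ℝ × ℝ) × (ℝ × ℝ) => (p.1.1, p.2.1)) (by fun_prop)
        (fun p hp => ⟨hp.1.1, hp.2.1⟩)
    have h2 : ContinuousOn (fun p : (ℝ × ℝ) × (ℝ × ℝ) => V (p.1.2, p.2.2)) Q :=
      hV.comp (f := fun p : (ℝ × ℝ) × (ℝ × ℝ) => (p.1.2, p.2.2)) (by fun_prop)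
        (fun p hp => ⟨hp.1.2, hp.2.2⟩)
    have h3 : Continuous θ := hθ.continuous
    exact ((h1.sub h2).sub (by fun_prop)).sub (by fun_prop)
  obtain ⟨⟨⟨s₀, s₀'⟩, ⟨t₀, τ₀⟩⟩, hx₀, hGx₀, hFx₀, hW⟩ :=
    exists_penalized_max (F := F) (G := G) hQ hFc (by fun_prop)
      (fun x _ => sq_nonneg _) ⟨((0, 0), (0, 0)), by simp [hQdef, hl.le, hT.le], by simp [hG]⟩
  obtain rfl : s₀ = s₀' := by
    simp only [hG] at hGx₀
    exact sub_eq_zero.1 (pow_eq_zero_iff two_ne_zero |>.1 hGx₀)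
  -- The limit point lies on the diagonal and maximizes there, so it is interior; nearby penalized
  -- maximizers are then interior as well.
  obtain ⟨hs₀, ht₀, hτ₀⟩ := hint s₀ hx₀.1.1 t₀ hx₀.2.1 τ₀ hx₀.2.2 (fun s hs t ht τ hτ =>
    hFx₀ ((s, s), (t, τ)) ⟨⟨hs, hs⟩, ⟨ht, hτ⟩⟩ (by simp [hG]))
  -- The doubled time slope is at least `-2kT`, so the subsolution inequality bounds the momentum of
  -- every penalized maximizer by `R`, independently of `n`.
  obtain ⟨R, hR⟩ := hH.coercive (2 * k * T + 1)
  have huc := (isCompact_Icc.prod (isCompact_Icc (a := -R) (b := R))).uniformContinuousOn_of_continuous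
    (hH.cont.mono (prod_mono_right (subset_univ _)))
  obtain ⟨δ, hδ, hδ'⟩ := Metric.uniformContinuousOn_iff.1 huc lam hlam
  have hopen : {p : (ℝ × ℝ) × (ℝ × ℝ) | |p.1.1 - p.1.2| < δ} ∩
      ((Ioo 0 l ×ˢ Ioo 0 l) ×ˢ (Ioo 0 T ×ˢ Ioo 0 T)) ∈ nhds ((s₀, s₀), (t₀, τ₀)) := by
    refine Filter.inter_mem ?_ (((isOpen_Ioo.prod isOpen_Ioo).prod
      (isOpen_Ioo.prod isOpen_Ioo)).mem_nhds ⟨⟨hs₀, hs₀⟩, ⟨ht₀, hτ₀⟩⟩)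
    exact (isOpen_lt (by fun_prop) continuous_const).mem_nhds (by simpa using hδ)
  obtain ⟨n, ⟨⟨s, s'⟩, ⟨t, τ⟩⟩, -, ⟨hss', ⟨hs, hs'⟩, ⟨ht, hτ⟩⟩, hmax⟩ := hW _ hopen
  replace hss' : |s - s'| < δ := hss'
  replace hs : s ∈ Ioo 0 l := hs
  replace hs' : s' ∈ Ioo 0 l := hs'
  replace ht : t ∈ Ioo 0 T := ht
  replace hτ : τ ∈ Ioo 0 T := hτ
  set N : ℝ := (n : ℝ)
  set a := 2 * k * (t - τ) with ha
  set p := 2 * N * (s - s') with hp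
  have hsubt : a + deriv θ t + H s p ≤ 0 := by
    have hloc : IsLocalMax (fun q : ℝ × ℝ => U q -
        (k * (q.2 - τ) ^ 2 + θ q.2 + N * (q.1 - s') ^ 2)) (s, t) := by
      filter_upwards [(isOpen_Ioo.prod isOpen_Ioo).mem_nhds
        (show (s, t) ∈ Ioo 0 l ×ˢ Ioo 0 T from ⟨hs, ht⟩)] with q hq
      have := hmax ((q.1, s'), (q.2, τ)) ⟨⟨Ioo_subset_Icc_self hq.1, Ioo_subset_Icc_self hs'⟩,
        ⟨Ioo_subset_Icc_self hq.2, Ioo_subset_Icc_self hτ⟩⟩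
      simp only [hF, hG] at this
      linarith
    have hcd : ContDiff ℝ 1 (fun q : ℝ × ℝ => k * (q.2 - τ) ^ 2 + θ q.2 + N * (q.1 - s') ^ 2) := by
      fun_prop
    have hres := hsub s hs t ht _ hcd hloc
    have hd1 : HasDerivAt (fun x => k * (x - τ) ^ 2 + θ x + N * (s - s') ^ 2)
        (a + deriv θ t) t := by
      have h1 := (((hasDerivAt_id t).sub_const τ).pow 2).const_mul k
      have h2 := (hθ.differentiable one_ne_zero t).hasDerivAt
      refine ((h1.add h2).add_const _).congr_deriv ?_
      simp [ha]
      ring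
    have hd2 : HasDerivAt (fun x => k * (t - τ) ^ 2 + θ t + N * (x - s') ^ 2) p s := by
      have h1 := (((hasDerivAt_id s).sub_const s').pow 2).const_mul N
      refine (h1.const_add _).congr_deriv ?_
      simp [hp]
      ring
    rw [residual, hd1.deriv, hd2.deriv] at hres
    exact hres
  have hsupt : 0 ≤ a + H s' p := by
    have hloc : IsLocalMin (fun q : ℝ × ℝ => V q -
        (-(k * (t - q.2) ^ 2) - N * (s - q.1) ^ 2)) (s', τ) := by
      filter_upwards [(isOpen_Ioo.prod isOpen_Ioo).mem_nhds
        (show (s', τ) ∈ Ioo 0 l ×ˢ Ioo 0 T from ⟨hs', hτ⟩)] with q hq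
      have := hmax ((s, q.1), (t, q.2)) ⟨⟨Ioo_subset_Icc_self hs, Ioo_subset_Icc_self hq.1⟩,
        ⟨Ioo_subset_Icc_self ht, Ioo_subset_Icc_self hq.2⟩⟩
      simp only [hF, hG] at this
      linarith
    have hcd : ContDiff ℝ 1 (fun q : ℝ × ℝ => -(k * (t - q.2) ^ 2) - N * (s - q.1) ^ 2) := by
      fun_prop
    have hres := hsup s' hs' τ hτ _ hcd hloc
    have hd1 : HasDerivAt (fun x => -(k * (t - x) ^ 2) - N * (s - s') ^ 2) a τ := by
      have h1 := ((((hasDerivAt_id τ).const_sub t).pow 2).const_mul k).neg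
      refine (h1.sub_const _).congr_deriv ?_
      simp [ha]
      ring
    have hd2 : HasDerivAt (fun x => -(k * (t - τ) ^ 2) - N * (s - x) ^ 2) p s' := by
      have h1 := (((hasDerivAt_id s').const_sub s).pow 2).const_mul N
      refine (h1.const_sub _).congr_deriv ?_
      simp [hp]
      ring
    rw [residual, hd1.deriv, hd2.deriv] at hres
    exact hres
  have hθt := hθ' t (Ioo_subset_Icc_self ht)
  have hpR : |p| < R := by
    by_contra! h
    have h1 := hR s (Ioo_subset_Icc_self hs) p h
    have h2 : k * (τ - t) ≤ k * T := mul_le_mul_of_nonneg_left (by linarith [hτ.2, ht.1]) hk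
    linarith
  have hpm : p ∈ Icc (-R) R := ⟨(abs_lt.1 hpR).1.le, (abs_lt.1 hpR).2.le⟩
  -- Subtracting the two viscosity inequalities gives `lam ≤ H s' p - H s p`, while `|s - s'| < δ`
  -- makes this difference less than `lam`.
  have := hδ' (s, p) ⟨Ioo_subset_Icc_self hs, hpm⟩ (s', p) ⟨Ioo_subset_Icc_self hs', hpm⟩
    (max_lt (show |s - s'| < δ from hss') (by simpa using hδ))
  rw [Real.dist_eq] at this
  linarith [(abs_lt.1 this).1]

namespace Network

variable {d : ℕ} (N : Network d)

/-! ### Comparison on networks -/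

lemma curve_mem_support (e : N.Arc) {s : ℝ} (hs : s ∈ Icc 0 (N.len e)) : N.curve e s ∈ N.support :=
  mem_iUnion.2 ⟨e, s, hs, rfl⟩

lemma continuousOn_curve (e : N.Arc) : ContinuousOn (N.curve e) (Icc 0 (N.len e)) :=
  (N.contDiffOn_curve e).continuousOn

lemma isCompact_support : IsCompact N.support := by
  have := N.finite_arc
  exact isCompact_iUnion fun e => isCompact_Icc.image_of_continuousOn (N.continuousOn_curve e)

lemma vertex_mem_support (x : N.vertices) : (x : EuclideanSpace ℝ (Fin d)) ∈ N.support := by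
  obtain ⟨x, e, h | h⟩ := x
  · exact h ▸ N.curve_mem_support e ⟨le_rfl, (N.len_pos e).le⟩
  · exact h ▸ N.curve_mem_support e ⟨(N.len_pos e).le, le_rfl⟩

lemma continuousOn_comp_curve {T : ℝ} {u : EuclideanSpace ℝ (Fin d) → ℝ → ℝ}
    (hu : ContinuousOn (fun p : EuclideanSpace ℝ (Fin d) × ℝ => u p.1 p.2) (N.support ×ˢ Icc 0 T))
    (e : N.Arc) :
    ContinuousOn (fun p : ℝ × ℝ => u (N.curve e p.1) p.2) (Icc 0 (N.len e) ×ˢ Icc 0 T) := by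
  have h : ContinuousOn (fun p : ℝ × ℝ => (N.curve e p.1, p.2)) (Icc 0 (N.len e) ×ˢ Icc 0 T) :=
    ((N.continuousOn_curve e).comp continuousOn_fst fun p hp => hp.1).prodMk continuousOn_snd
  exact hu.comp h fun p hp => ⟨N.curve_mem_support e hp.1, hp.2⟩

/-- Subsolutions in the open time interval, without initial condition. -/
structure IsOpenSubsolution (H : N.Arc → ℝ → ℝ → ℝ) (c : N.vertices → ℝ) (T : ℝ)
    (u : EuclideanSpace ℝ (Fin d) → ℝ → ℝ) : Prop where
  cont : ContinuousOn (fun p : EuclideanSpace ℝ (Fin d) × ℝ => u p.1 p.2)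
    (N.support ×ˢ Icc 0 T)
  interior : ∀ e, IsViscSub (H e) (N.len e) T (fun p => u (N.curve e p.1) p.2)
  vertex : ∀ x : N.vertices, ∀ t₀ ∈ Ioo 0 T, ∀ ψ : ℝ → ℝ, ContDiff ℝ 1 ψ →
    IsLocalMax (fun t => u x t - ψ t) t₀ → deriv ψ t₀ ≤ c x

/-- Supersolutions in the open time interval, without initial condition. -/
structure IsOpenSupersolution (P : Set N.Arc) (H : N.Arc → ℝ → ℝ → ℝ) (c : N.vertices → ℝ) (T : ℝ)
    (u : EuclideanSpace ℝ (Fin d) → ℝ → ℝ) : Prop where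
  cont : ContinuousOn (fun p : EuclideanSpace ℝ (Fin d) × ℝ => u p.1 p.2)
    (N.support ×ˢ Icc 0 T)
  interior : ∀ e, IsViscSuper (H e) (N.len e) T (fun p => u (N.curve e p.1) p.2)
  vertex : ∀ x : N.vertices, ∀ t₀ ∈ Ioo 0 T,
    (∃ ψ : ℝ → ℝ, ContDiff ℝ 1 ψ ∧ IsLocalMin (fun t => u x t - ψ t) t₀ ∧ deriv ψ t₀ < c x) →
    ∃ e ∈ P, ∃ s : ℝ, (s = 0 ∨ s = N.len e) ∧ N.curve e s = x ∧
      ∀ φ : ℝ × ℝ → ℝ, ContDiff ℝ 1 φ →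
        IsLocalMinOn (fun p : ℝ × ℝ => u (N.curve e p.1) p.2 - φ p)
          (Icc 0 (N.len e) ×ˢ Icc 0 T) (s, t₀) →
        0 ≤ residual (H e) φ s t₀

section Comparison

variable {N} {P : Set N.Arc} {H : N.Arc → ℝ → ℝ → ℝ} {c : N.vertices → ℝ} {T : ℝ}
  {u v : EuclideanSpace ℝ (Fin d) → ℝ → ℝ}

/-- The doubled difference of a subsolution and a supersolution cannot attain its maximum at a
vertex. -/
lemma false_of_vertex_max (hH : ∀ e, IsCoerciveH (H e) (N.len e))
    (hflux : ∀ x : N.vertices, ∀ e ∈ P, ∀ s, (s = 0 ∨ s = N.len e) → N.curve e s = x →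
      ∃ q, H e s q ≤ -c x)
    (hu : N.IsOpenSubsolution H c T u) (hv : N.IsOpenSupersolution P H c T v) {k : ℝ} {θ : ℝ → ℝ}
    (hθ : ContDiff ℝ 1 θ) {t₀ τ₀ : ℝ} (ht₀ : t₀ ∈ Ioo 0 T) (hτ₀ : τ₀ ∈ Ioo 0 T)
    (hθ' : 0 < deriv θ t₀) (x : N.vertices)
    (hmax : ∀ y ∈ N.support, ∀ t ∈ Icc 0 T, ∀ τ ∈ Icc 0 T,
      u y t - v y τ - k * (t - τ) ^ 2 - θ t ≤ u x t₀ - v x τ₀ - k * (t₀ - τ₀) ^ 2 - θ t₀) :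
    False := by
  -- Since `deriv θ t₀ > 0`, this puts the slope `2k(t₀ - τ₀)`, shared by the subtangent in `τ`,
  -- strictly below `c x`.
  have h1 : 2 * k * (t₀ - τ₀) + deriv θ t₀ ≤ c x := by
    have hd : HasDerivAt (fun t => k * (t - τ₀) ^ 2 + θ t) (2 * k * (t₀ - τ₀) + deriv θ t₀) t₀ := by
      have h1 := (((hasDerivAt_id t₀).sub_const τ₀).pow 2).const_mul k
      have h2 := (hθ.differentiable one_ne_zero t₀).hasDerivAt
      refine (h1.add h2).congr_deriv ?_
      simp
      ring
    rw [← hd.deriv]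
    refine hu.vertex x t₀ ht₀ _ (by fun_prop) ?_
    filter_upwards [isOpen_Ioo.mem_nhds ht₀] with t ht
    have := hmax x (N.vertex_mem_support x) t (Ioo_subset_Icc_self ht) τ₀ (Ioo_subset_Icc_self hτ₀)
    linarith
  obtain ⟨e, heP, s, hs, hsx, hφ⟩ := hv.vertex x τ₀ hτ₀ (by
    refine ⟨fun τ => -(k * (t₀ - τ) ^ 2), by fun_prop, ?_, ?_⟩
    · filter_upwards [isOpen_Ioo.mem_nhds hτ₀] with τ hτ
      have := hmax x (N.vertex_mem_support x) t₀ (Ioo_subset_Icc_self ht₀) τ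
        (Ioo_subset_Icc_self hτ)
      linarith
    · have hd : HasDerivAt (fun τ => -(k * (t₀ - τ) ^ 2)) (2 * k * (t₀ - τ₀)) τ₀ := by
        refine ((((hasDerivAt_id τ₀).const_sub t₀).pow 2).const_mul k).neg.congr_deriv ?_
        simp
        ring
      rw [hd.deriv]
      linarith)
  obtain ⟨q, hq⟩ := hflux x e heP s hs hsx
  have hq' : ∃ q, H e s q ≤ -(2 * k * (t₀ - τ₀)) - deriv θ t₀ := ⟨q, by linarith⟩
  have hmax' : ∀ s' ∈ Icc 0 (N.len e), ∀ t ∈ Icc 0 T, ∀ τ ∈ Icc 0 T,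
      u (N.curve e s') t - v (N.curve e s') τ - k * (t - τ) ^ 2 - θ t
        ≤ u (N.curve e s) t₀ - v (N.curve e s) τ₀ - k * (t₀ - τ₀) ^ 2 - θ t₀ := by
    intro s' hs' t ht τ hτ
    rw [hsx]
    exact hmax _ (N.curve_mem_support e hs') t ht τ hτ
  have hU := N.continuousOn_comp_curve hu.cont e
  rcases hs with rfl | rfl
  · obtain ⟨φ, h1, h2, h3⟩ := exists_subtangent_left (V := fun p => v (N.curve e p.1) p.2)
      (N.len_pos e) (hH e) hU (hu.interior e) hθ ht₀ hmax' hθ' hq'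
    exact absurd (hφ φ h1 h2) (not_le.2 h3)
  · obtain ⟨φ, h1, h2, h3⟩ := exists_subtangent_right (V := fun p => v (N.curve e p.1) p.2)
      (N.len_pos e) (hH e) hU (hu.interior e) hθ ht₀ hmax' hθ' hq'
    exact absurd (hφ φ h1 h2) (not_le.2 h3)

/-- The comparison principle. -/
theorem comparison (hT : 0 < T) (hH : ∀ e, IsCoerciveH (H e) (N.len e))
    (hflux : ∀ x : N.vertices, ∀ e ∈ P, ∀ s, (s = 0 ∨ s = N.len e) → N.curve e s = x →
      ∃ q, H e s q ≤ -c x)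
    (hu : N.IsOpenSubsolution H c T u) (hv : N.IsOpenSupersolution P H c T v)
    (h0 : ∀ x ∈ N.support, u x 0 ≤ v x 0) :
    ∀ x ∈ N.support, ∀ t ∈ Icc 0 T, u x t ≤ v x t := by
  suffices hopen : ∀ x ∈ N.support, ∀ t ∈ Ioo 0 T, u x t ≤ v x t by
    intro x hx t ht
    have hc : ∀ w : EuclideanSpace ℝ (Fin d) → ℝ → ℝ,
        ContinuousOn (fun p : EuclideanSpace ℝ (Fin d) × ℝ => w p.1 p.2) (N.support ×ˢ Icc 0 T) →
        ContinuousOn (w x) (Icc 0 T) := fun w hw =>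
      hw.comp (f := fun t : ℝ => (x, t)) (by fun_prop) fun t ht => ⟨hx, ht⟩
    have hcl : closure (Ioo 0 T) = Icc 0 T := closure_Ioo hT.ne
    refine le_on_closure (s := Ioo 0 T) (f := u x) (g := v x) (hopen x hx) ?_ ?_ (hcl ▸ ht)
    · rw [hcl]; exact hc u hu.cont
    · rw [hcl]; exact hc v hv.cont
  intro x₁ hx₁ t₁ ht₁
  by_contra! hlt
  set α := u x₁ t₁ - v x₁ t₁ with hα
  have hα0 : 0 < α := by linarith
  have hK : IsCompact (N.support ×ˢ Icc 0 T) := N.isCompact_support.prod isCompact_Icc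
  obtain ⟨B₁, hB₁⟩ := hK.exists_bound_of_continuousOn hu.cont
  obtain ⟨B₂, hB₂⟩ := hK.exists_bound_of_continuousOn hv.cont
  have hBu : ∀ x ∈ N.support, ∀ t ∈ Icc 0 T, |u x t| ≤ B₁ := fun x hx t ht => hB₁ (x, t) ⟨hx, ht⟩
  have hBv : ∀ x ∈ N.support, ∀ t ∈ Icc 0 T, |v x t| ≤ B₂ := fun x hx t ht => hB₂ (x, t) ⟨hx, ht⟩
  have hmod : ∀ w : EuclideanSpace ℝ (Fin d) → ℝ → ℝ,
      ContinuousOn (fun p : EuclideanSpace ℝ (Fin d) × ℝ => w p.1 p.2) (N.support ×ˢ Icc 0 T) →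
      ∃ δ > 0, ∀ x ∈ N.support, ∀ t ∈ Icc 0 T, ∀ t' ∈ Icc 0 T, |t - t'| < δ →
        |w x t - w x t'| < α / 4 := by
    intro w hw
    obtain ⟨δ, hδ, h⟩ := Metric.uniformContinuousOn_iff.1 (hK.uniformContinuousOn_of_continuous hw)
      (α / 4) (by linarith)
    exact ⟨δ, hδ, fun x hx t ht t' ht' htt' => h (x, t) ⟨hx, ht⟩ (x, t') ⟨hx, ht'⟩
      (max_lt (by simpa using hδ) (show |t - t'| < δ from htt'))⟩
  obtain ⟨δ₁, hδ₁, hmu⟩ := hmod u hu.cont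
  obtain ⟨δ₂, hδ₂, hmv⟩ := hmod v hv.cont
  -- The penalty `θ` forces `t < T₁`, and the penalty `k` forces `|t - τ| < δ ≤ T - T₁`, hence `τ <
  -- T`. The moduli at `δ₁`, `δ₂` serve to exclude the initial time.
  set T₁ := (t₁ + T) / 2 with hT₁
  set δ := min (min δ₁ δ₂) (T - T₁) with hδ
  have hT₁T : T₁ < T := by linarith [ht₁.2]
  have ht₁T₁ : t₁ < T₁ := by linarith [ht₁.2]
  have hδ0 : 0 < δ := lt_min (lt_min hδ₁ hδ₂) (by linarith)
  obtain ⟨K, hK0, hKlarge⟩ := exists_exp_large ht₁T₁ (η := α / 2) (by linarith) (B₁ + B₂ + 1)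
  set θ : ℝ → ℝ := fun t => α / 2 * Real.exp (K * (t - t₁)) with hθdef
  have hθ : ContDiff ℝ 1 θ := by fun_prop
  have hθd : ∀ t, deriv θ t = α / 2 * (Real.exp (K * (t - t₁)) * K) := by
    intro t
    have h1 := ((((hasDerivAt_id t).sub_const t₁).const_mul K).exp).const_mul (α / 2)
    exact h1.deriv.trans (by simp)
  have hθpos : ∀ t, 0 < θ t := fun t => by simp only [hθdef]; positivity
  set k := (B₁ + B₂ + 1) / δ ^ 2 with hk
  have hB0 : 0 ≤ B₁ + B₂ :=
    add_nonneg ((abs_nonneg _).trans (hBu x₁ hx₁ t₁ (Ioo_subset_Icc_self ht₁)))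
      ((abs_nonneg _).trans (hBv x₁ hx₁ t₁ (Ioo_subset_Icc_self ht₁)))
  have hk0 : 0 < k := by positivity
  have hkδ : k * δ ^ 2 = B₁ + B₂ + 1 := by rw [hk]; field_simp
  -- any maximizer has times in the open interval
  have htimes : ∀ x ∈ N.support, ∀ t ∈ Icc 0 T, ∀ τ ∈ Icc 0 T,
      α / 2 ≤ u x t - v x τ - k * (t - τ) ^ 2 - θ t → t ∈ Ioo 0 T ∧ τ ∈ Ioo 0 T := by
    intro x hx t ht τ hτ hval
    have b1 := (abs_le.1 (hBu x hx t ht)).2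
    have b2 := (abs_le.1 (hBv x hx τ hτ)).1
    have hkt : 0 ≤ k * (t - τ) ^ 2 := by positivity
    have hθt := hθpos t
    have hclose : |t - τ| < δ := by
      by_contra! h
      have h1 : δ ^ 2 ≤ (t - τ) ^ 2 := by
        rw [← sq_abs (t - τ)]; exact pow_le_pow_left₀ hδ0.le h 2
      have := mul_le_mul_of_nonneg_left h1 hk0.le
      linarith
    have hc1 : |t - τ| < δ₁ := hclose.trans_le ((min_le_left _ _).trans (min_le_left _ _))
    have hc2 : |t - τ| < δ₂ := hclose.trans_le ((min_le_left _ _).trans (min_le_right _ _))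
    have hc3 : |t - τ| < T - T₁ := hclose.trans_le (min_le_right _ _)
    have htT₁ : t < T₁ := by
      by_contra! h
      have := hKlarge t h
      simp only [hθdef] at hval
      linarith
    have hx0 := h0 x hx
    have h0T : (0 : ℝ) ∈ Icc 0 T := ⟨le_rfl, hT.le⟩
    refine ⟨⟨?_, htT₁.trans hT₁T⟩, ⟨?_, by linarith [(abs_lt.1 hc3).1]⟩⟩
    · rcases ht.1.eq_or_lt with h | h
      · subst h
        have := (abs_lt.1 (hmv x hx 0 h0T τ hτ hc2)).2
        linarith
      · exact h
    · rcases hτ.1.eq_or_lt with h | h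
      · subst h
        have := (abs_lt.1 (hmu x hx t ht 0 h0T hc1)).2
        linarith
      · exact h
  set Φ : EuclideanSpace ℝ (Fin d) × (ℝ × ℝ) → ℝ := fun p =>
    u p.1 p.2.1 - v p.1 p.2.2 - k * (p.2.1 - p.2.2) ^ 2 - θ p.2.1 with hΦ
  have hΦc : ContinuousOn Φ (N.support ×ˢ (Icc 0 T ×ˢ Icc 0 T)) := by
    have h1 : ContinuousOn (fun p : EuclideanSpace ℝ (Fin d) × (ℝ × ℝ) => u p.1 p.2.1)
        (N.support ×ˢ (Icc 0 T ×ˢ Icc 0 T)) :=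
      hu.cont.comp (f := fun p : EuclideanSpace ℝ (Fin d) × (ℝ × ℝ) => (p.1, p.2.1))
        (by fun_prop) fun p hp => ⟨hp.1, hp.2.1⟩
    have h2 : ContinuousOn (fun p : EuclideanSpace ℝ (Fin d) × (ℝ × ℝ) => v p.1 p.2.2)
        (N.support ×ˢ (Icc 0 T ×ˢ Icc 0 T)) :=
      hv.cont.comp (f := fun p : EuclideanSpace ℝ (Fin d) × (ℝ × ℝ) => (p.1, p.2.2))
        (by fun_prop) fun p hp => ⟨hp.1, hp.2.2⟩
    have h3 : Continuous θ := hθ.continuous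
    exact ((h1.sub h2).sub (by fun_prop)).sub (by fun_prop)
  obtain ⟨⟨x₀, ⟨t₀, τ₀⟩⟩, ⟨hx₀, ht₀, hτ₀⟩, hmax₀⟩ :=
    (N.isCompact_support.prod (isCompact_Icc.prod isCompact_Icc)).exists_isMaxOn
      ⟨(x₁, (t₁, t₁)), hx₁, Ioo_subset_Icc_self ht₁, Ioo_subset_Icc_self ht₁⟩ hΦc
  replace hx₀ : x₀ ∈ N.support := hx₀
  replace ht₀ : t₀ ∈ Icc 0 T := ht₀
  replace hτ₀ : τ₀ ∈ Icc 0 T := hτ₀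
  have hmax : ∀ y ∈ N.support, ∀ t ∈ Icc 0 T, ∀ τ ∈ Icc 0 T,
      u y t - v y τ - k * (t - τ) ^ 2 - θ t ≤ u x₀ t₀ - v x₀ τ₀ - k * (t₀ - τ₀) ^ 2 - θ t₀ :=
    fun y hy t ht τ hτ => hmax₀ (show (y, (t, τ)) ∈ N.support ×ˢ (Icc 0 T ×ˢ Icc 0 T) from
      ⟨hy, ht, hτ⟩)
  have hval : α / 2 ≤ u x₀ t₀ - v x₀ τ₀ - k * (t₀ - τ₀) ^ 2 - θ t₀ := by
    refine le_trans (le_of_eq ?_) (hmax x₁ hx₁ t₁ (Ioo_subset_Icc_self ht₁) t₁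
      (Ioo_subset_Icc_self ht₁))
    simp [hθdef, ← hα]
    ring
  have hθd0 : ∀ t, 0 < deriv θ t := fun t => by rw [hθd]; positivity
  -- On an arc through the maximizer, any maximizer over the arc is one over the whole network,
  -- hence cannot sit at a vertex. The constant `lam` is `deriv θ 0`, the minimum of `deriv θ`.
  obtain ⟨e, s₀, hs₀, hes₀⟩ := mem_iUnion.1 hx₀
  refine false_of_interior_max (U := fun p => u (N.curve e p.1) p.2)
    (V := fun p => v (N.curve e p.1) p.2) (k := k) (lam := α / 2 * (Real.exp (K * (0 - t₁)) * K))
    (N.len_pos e) hT hk0.le (hH e)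
    (N.continuousOn_comp_curve hu.cont e) (N.continuousOn_comp_curve hv.cont e) (hu.interior e)
    (hv.interior e) hθ (by positivity) (fun t ht => ?_) (fun s hs t ht τ hτ hst => ?_)
  · rw [hθd]
    have : K * (0 - t₁) ≤ K * (t - t₁) := mul_le_mul_of_nonneg_left (by linarith [ht.1]) hK0.le
    gcongr
  · have h1 : u x₀ t₀ - v x₀ τ₀ - k * (t₀ - τ₀) ^ 2 - θ t₀ ≤
        u (N.curve e s) t - v (N.curve e s) τ - k * (t - τ) ^ 2 - θ t := by
      have := hst s₀ hs₀ t₀ ht₀ τ₀ hτ₀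
      simpa only [hes₀] using this
    obtain ⟨ht', hτ'⟩ := htimes _ (N.curve_mem_support e hs) t ht τ hτ (hval.trans h1)
    have hno : ∀ x : N.vertices, N.curve e s ≠ x := by
      intro x hx
      refine false_of_vertex_max hH hflux hu hv hθ ht' hτ' (hθd0 t) x (k := k)
        (fun y hy t' ht' τ' hτ' => ?_)
      rw [← hx]
      exact (hmax y hy t' ht' τ' hτ').trans h1
    refine ⟨⟨hs.1.lt_of_ne ?_, hs.2.lt_of_ne ?_⟩, ht', hτ'⟩
    · rintro rfl
      exact hno ⟨N.curve e 0, e, Or.inl rfl⟩ rfl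
    · rintro rfl
      exact hno ⟨N.curve e (N.len e), e, Or.inr rfl⟩ rfl

end Comparison

end Network

/-! ### One-sided difference quotients -/

lemma le_deriv_of_right {f : ℝ → ℝ} {p c : ℝ} (hf : HasDerivAt f p 0)
    (h : ∀ᶠ x in nhdsWithin 0 (Ioi 0), c * x ≤ f x - f 0) : c ≤ p := by
  have h1 := hf.tendsto_slope_zero_right
  refine ge_of_tendsto h1 ?_
  filter_upwards [h, self_mem_nhdsWithin] with x hx hx0
  rw [zero_add, smul_eq_mul, inv_mul_eq_div, le_div_iff₀ hx0]
  exact hx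

lemma le_deriv_of_forall_right {f : ℝ → ℝ} {p c t : ℝ} (hf : HasDerivAt f p t)
    (h : ∀ᶠ x in nhdsWithin 0 (Ioi 0), c * x ≤ f (t + x) - f t) : c ≤ p := by
  have hf' : HasDerivAt (fun x => f (t + x)) p 0 := HasDerivAt.comp_const_add t 0 (by simpa using hf)
  exact le_deriv_of_right hf' (by simpa using h)

lemma le_deriv_of_forall_left {f : ℝ → ℝ} {p c t : ℝ} (hf : HasDerivAt f p t)
    (h : ∀ᶠ x in nhdsWithin 0 (Ioi 0), c * x ≤ f t - f (t - x)) : c ≤ p := by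
  have hf' : HasDerivAt (fun x => -f (t - x)) p 0 :=
    (HasDerivAt.comp_const_sub t 0 (by simpa using hf)).fun_neg.congr_deriv (neg_neg p)
  refine le_deriv_of_right hf' ?_
  filter_upwards [h] with x hx
  simp only [sub_zero]
  linarith

/-! ### Almost everywhere subsolutions in space -/

/-- Increments of a Lipschitz function, bounded through its almost everywhere derivative. -/
lemma sub_le_of_ae_deriv_le {G : ℝ → ℝ} {K : NNReal} {x y c : ℝ} (hxy : x ≤ y)
    (hG : LipschitzOnWith K G (Icc x y))
    (hd : ∀ᵐ s ∂(volume.restrict (Icc x y)), deriv G s ≤ c) : G y - G x ≤ c * (y - x) := by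
  have hac : AbsolutelyContinuousOnInterval G x y :=
    LipschitzOnWith.absolutelyContinuousOnInterval (by rwa [uIcc_of_le hxy])
  rw [← hac.integral_deriv_eq_sub]
  have h := intervalIntegral.integral_mono_ae_restrict hxy hac.intervalIntegrable_deriv
    (intervalIntegrable_const (c := c)) hd
  rw [intervalIntegral.integral_const, smul_eq_mul] at h
  linarith

/-- Supergradients of a Lipschitz almost everywhere subsolution of `H(s, G') ≤ M`. -/
lemma hamiltonian_le_of_ae {H : ℝ → ℝ → ℝ} {l M M' : ℝ} {G : ℝ → ℝ} {K : NNReal}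
    (hH : IsCoerciveH H l) (hG : LipschitzOnWith K G (Icc 0 l)) (hM : M < M')
    (hae : ∀ᵐ s ∂(volume.restrict (Icc 0 l)), H s (deriv G s) ≤ M) {s : ℝ} (hs : s ∈ Ioo 0 l)
    {ψ : ℝ → ℝ} (hψ : DifferentiableAt ℝ ψ s) (hmax : IsLocalMax (fun σ => G σ - ψ σ) s) :
    H s (deriv ψ s) ≤ M' := by
  by_contra! hlt
  set p := deriv ψ s with hp
  have hsI : s ∈ Icc 0 l := Ioo_subset_Icc_self hs
  obtain ⟨ε, hε, hε'⟩ : ∃ ε > 0, ∀ q, |q - p| ≤ ε → M' < H s q := by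
    have := (hH.continuous_right hsI).continuousAt.eventually (lt_mem_nhds hlt)
    obtain ⟨ε, hε, h⟩ := Metric.eventually_nhds_iff.1 this
    exact ⟨ε / 2, by linarith, fun q hq => h (by rw [Real.dist_eq]; linarith)⟩
  -- The sublevel set of `H s` is an interval that misses a neighbourhood of `p`, so it lies on one
  -- side.
  have hdich : (∀ q, H s q ≤ M' → q ≤ p - ε) ∨ (∀ q, H s q ≤ M' → p + ε ≤ q) := by
    by_contra! hcon
    obtain ⟨⟨q₁, h1, h1'⟩, ⟨q₂, h2, h2'⟩⟩ := hcon
    have h3 : p + ε < q₁ := by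
      by_contra! h
      exact absurd (hε' q₁ (abs_le.2 ⟨by linarith, by linarith⟩)) (not_lt.2 h1)
    have h4 : q₂ < p - ε := by
      by_contra! h
      exact absurd (hε' q₂ (abs_le.2 ⟨by linarith, by linarith⟩)) (not_lt.2 h2)
    have hconv := (hH.convex s hsI).convex_le M'
    have := hconv.ordConnected.out (x := q₂) ⟨mem_univ _, h2⟩ (y := q₁) ⟨mem_univ _, h1⟩
      (show p ∈ Icc q₂ q₁ from ⟨by linarith, by linarith⟩)
    exact absurd hlt (not_lt.2 this.2)
  -- The gap `M' - M` absorbs the error of freezing the space variable at `s`.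
  have huc := (isCompact_Icc.prod (isCompact_Icc (a := -(K : ℝ)) (b := K))).uniformContinuousOn_of_continuous
    (hH.cont.mono (prod_mono_right (subset_univ _)))
  obtain ⟨δ, hδ, hδ'⟩ := Metric.uniformContinuousOn_iff.1 huc (M' - M) (by linarith)
  set r := min (δ / 2) (min (s / 2) ((l - s) / 2)) with hr
  have hr0 : 0 < r :=
    lt_min (by linarith) (lt_min (by linarith [hs.1]) (by linarith [hs.2]))
  have hr1 : r < δ := (min_le_left _ _).trans_lt (by linarith)
  have hr2 : r < s := ((min_le_right _ _).trans (min_le_left _ _)).trans_lt (by linarith [hs.1])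
  have hr3 : r < l - s :=
    ((min_le_right _ _).trans (min_le_right _ _)).trans_lt (by linarith [hs.2])
  have hnear : Icc (s - r) (s + r) ⊆ Ioo 0 l := fun σ hσ =>
    ⟨by linarith [hσ.1], by linarith [hσ.2]⟩
  have hnear' : Icc (s - r) (s + r) ⊆ Icc 0 l := hnear.trans Ioo_subset_Icc_self
  have hae' : ∀ᵐ σ ∂(volume.restrict (Icc (s - r) (s + r))), H s (deriv G σ) ≤ M' := by
    filter_upwards [ae_restrict_of_ae_restrict_of_subset hnear' hae,
      ae_restrict_mem measurableSet_Icc] with σ h1 h2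
    have h3 : |deriv G σ| ≤ K :=
      norm_deriv_le_of_lipschitzOn (Icc_mem_nhds (hnear h2).1 (hnear h2).2) hG
    have h4 := hδ' (s, deriv G σ) ⟨hsI, abs_le.1 h3⟩ (σ, deriv G σ) ⟨hnear' h2, abs_le.1 h3⟩
      (max_lt (show |s - σ| < δ from
        (abs_le.2 ⟨by linarith [h2.2], by linarith [h2.1]⟩ : |s - σ| ≤ r).trans_lt hr1)
        (by simpa using hδ))
    rw [Real.dist_eq] at h4
    linarith [(abs_lt.1 h4).2]
  have hψd : HasDerivAt ψ p s := hψ.hasDerivAt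
  have hr' : ∀ᶠ x in nhdsWithin (0 : ℝ) (Ioi 0), x ∈ Ioo 0 r := Ioo_mem_nhdsGT hr0
  -- The side decides the direction: integrating `deriv G ≤ p - ε` to the left of `s`, or `deriv G ≥
  -- p + ε` to its right, forces the slope of `ψ` away from `p`.
  rcases hdich with hd | hd
  · have key : ∀ᶠ x in nhdsWithin (0 : ℝ) (Ioi 0), -(p - ε) * x ≤ -ψ s - -ψ (s - x) := by
      have hm : ∀ᶠ x in nhdsWithin (0 : ℝ) (Ioi 0), G (s - x) - ψ (s - x) ≤ G s - ψ s := by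
        have ht : Filter.Tendsto (fun x : ℝ => s - x) (nhds 0) (nhds s) := by
          have : Continuous fun x : ℝ => s - x := by fun_prop
          simpa using this.tendsto 0
        exact (ht.eventually hmax).filter_mono nhdsWithin_le_nhds
      filter_upwards [hm, hr'] with x h1 h2
      have hsub : Icc (s - x) s ⊆ Icc (s - r) (s + r) :=
        Icc_subset_Icc (by linarith [h2.2]) (by linarith)
      have h3 := sub_le_of_ae_deriv_le (c := p - ε) (by linarith [h2.1] : s - x ≤ s)
        (hG.mono (hsub.trans hnear')) (by
          filter_upwards [ae_restrict_of_ae_restrict_of_subset hsub hae'] with σ hσ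
          exact hd _ hσ)
      linarith
    linarith [le_deriv_of_forall_left hψd.neg key]
  · have key : ∀ᶠ x in nhdsWithin (0 : ℝ) (Ioi 0), (p + ε) * x ≤ ψ (s + x) - ψ s := by
      have hm : ∀ᶠ x in nhdsWithin (0 : ℝ) (Ioi 0), G (s + x) - ψ (s + x) ≤ G s - ψ s := by
        have ht : Filter.Tendsto (fun x : ℝ => s + x) (nhds 0) (nhds s) := by
          have : Continuous fun x : ℝ => s + x := by fun_prop
          simpa using this.tendsto 0
        exact (ht.eventually hmax).filter_mono nhdsWithin_le_nhds
      filter_upwards [hm, hr'] with x h1 h2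
      have hsub : Icc s (s + x) ⊆ Icc (s - r) (s + r) :=
        Icc_subset_Icc (by linarith) (by linarith [h2.2])
      have h3 := sub_le_of_ae_deriv_le (G := fun σ => -G σ) (c := -(p + ε))
        (by linarith [h2.1] : s ≤ s + x) (hG.mono (hsub.trans hnear')).neg (by
          filter_upwards [ae_restrict_of_ae_restrict_of_subset hsub hae'] with σ hσ
          rw [deriv.fun_neg]
          exact neg_le_neg (hd _ hσ))
      linarith
    linarith [le_deriv_of_forall_right hψd key]

namespace Network

variable {d : ℕ} {N : Network d} {P : Set N.Arc} {Ht H : N.Arc → ℝ → ℝ → ℝ}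
  {c : N.vertices → ℝ} {g : EuclideanSpace ℝ (Fin d) → ℝ} {T : ℝ}
  {u : EuclideanSpace ℝ (Fin d) → ℝ → ℝ}

/-! ### Consequences of the standing assumptions -/

lemma IsHamiltonian.isCoerciveH (hHt : N.IsHamiltonian Ht) (e : N.Arc) :
    IsCoerciveH (Ht e) (N.len e) where
  cont := hHt.cont e
  convex := hHt.convex e
  coercive C := by
    obtain ⟨R, hR⟩ := hHt.superlinear e 1
    refine ⟨max R C, fun s hs μ hμ => ?_⟩
    have := hR s hs μ ((le_max_left _ _).trans hμ)
    linarith [le_max_right R C]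

/-- Coercivity makes the infimum finite and attained, and the supremum bounded, so that neither
takes a default value and `fluxBound` is the true max-min. -/
lemma IsFluxLimiter.exists_le (hc : N.IsFluxLimiter P Ht c) (hHt : N.IsHamiltonian Ht)
    (x : N.vertices) {e : N.Arc} (he : e ∈ P)
    (hx : (x : EuclideanSpace ℝ (Fin d)) = N.curve e 0 ∨
      (x : EuclideanSpace ℝ (Fin d)) = N.curve e (N.len e)) {s : ℝ} (hs : s ∈ Icc 0 (N.len e)) :
    ∃ q, Ht e s q ≤ -c x := by
  have hco := hHt.isCoerciveH e
  have hbelow : ∀ s : Icc 0 (N.len e), BddBelow (range fun μ => Ht e s μ) := by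
    intro s
    obtain ⟨q, hq⟩ := hco.exists_min s.2
    exact ⟨_, by rintro y ⟨μ, rfl⟩; exact hq μ⟩
  obtain ⟨B, hB⟩ := isCompact_Icc.exists_bound_of_continuousOn (hco.continuousOn_left 0)
  have habove : BddAbove (range fun s : Icc 0 (N.len e) => ⨅ μ : ℝ, Ht e s μ) := by
    refine ⟨B, ?_⟩
    rintro y ⟨s, rfl⟩
    exact (ciInf_le (hbelow s) 0).trans ((le_abs_self _).trans (hB s s.2))
  obtain ⟨q, hq⟩ := hco.exists_min hs
  have h1 : Ht e s q ≤ ⨅ μ : ℝ, Ht e s μ := le_ciInf hq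
  have h2 := le_ciSup habove ⟨s, hs⟩
  have h3 := hc x e he hx
  rw [fluxBound] at h3
  exact ⟨q, by linarith⟩

lemma abs_le_level (x : N.vertices) : |c x| ≤ N.level Ht g c := by
  have := N.finite_arc
  have hfin : N.vertices.Finite := by
    have : N.vertices ⊆ (range fun e => N.curve e 0) ∪ range fun e => N.curve e (N.len e) := by
      rintro x ⟨e, h | h⟩
      · exact Or.inl ⟨e, h.symm⟩
      · exact Or.inr ⟨e, h.symm⟩
    exact ((finite_range _).union (finite_range _)).subset this
  have := hfin.to_subtype
  exact (le_ciSup (finite_range fun x : N.vertices => |c x|).bddAbove x).trans (le_max_right _ _)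

/-- The minimum of `Ht e s` is at most `-c x ≤ |c x| ≤ A`. Arcs outside the orientation are reached
through their reversals. -/
lemma exists_le_level (hP : N.IsOrientation P) (hHt : N.IsHamiltonian Ht)
    (hc : N.IsFluxLimiter P Ht c) (e : N.Arc) {s : ℝ} (hs : s ∈ Icc 0 (N.len e)) :
    ∃ q, Ht e s q ≤ N.level Ht g c := by
  have key : ∀ e ∈ P, ∀ s ∈ Icc 0 (N.len e), ∃ q, Ht e s q ≤ N.level Ht g c := by
    intro e he s hs
    obtain ⟨q, hq⟩ := hc.exists_le hHt ⟨N.curve e 0, e, Or.inl rfl⟩ he (Or.inl rfl) hs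
    exact ⟨q, hq.trans ((neg_le_abs _).trans (abs_le_level _))⟩
  by_cases he : e ∈ P
  · exact key e he s hs
  · have he' : N.rev e ∈ P := by
      by_contra h
      exact he ((hP e).2 h)
    have hs' : N.len e - s ∈ Icc 0 (N.len e) := ⟨by linarith [hs.2], by linarith [hs.1]⟩
    obtain ⟨q, hq⟩ := key (N.rev e) he' (N.len e - s) (by rwa [N.len_rev])
    rw [hHt.compat e _ hs', sub_sub_cancel] at hq
    exact ⟨-q, hq⟩

lemma lipschitzOnWith_curve (e : N.Arc) : LipschitzOnWith 1 (N.curve e) (Icc 0 (N.len e)) :=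
  (convex_Icc _ _).lipschitzOnWith_of_nnnorm_derivWithin_le
    ((N.contDiffOn_curve e).differentiableOn one_ne_zero)
    fun s hs => by
      rw [← NNReal.coe_le_coe, coe_nnnorm, N.unit_speed e s hs, NNReal.coe_one]

/-- The summand `1` in `level` gives the strict inequality, which is the room that
`hamiltonian_le_of_ae` requires. -/
lemma exists_ae_le_lt_level (hHt : N.IsHamiltonian Ht) {K : NNReal}
    (hg : LipschitzOnWith K g N.support) (e : N.Arc) :
    ∃ m < N.level Ht g c, ∀ᵐ s ∂(volume.restrict (Icc 0 (N.len e))),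
      Ht e s (deriv (fun σ => g (N.curve e σ)) s) ≤ m := by
  have := N.finite_arc
  have hG : LipschitzOnWith K (fun σ => g (N.curve e σ)) (Icc 0 (N.len e)) := by
    have := hg.comp (lipschitzOnWith_curve e) fun s hs => N.curve_mem_support e hs
    rwa [mul_one] at this
  set S := {m : ℝ | ∀ᵐ s ∂(volume.restrict (Icc 0 (N.len e))),
    Ht e s (deriv (fun σ => g (N.curve e σ)) s) ≤ m} with hS
  have hne : S.Nonempty := by
    obtain ⟨B, hB⟩ := (isCompact_Icc.prod (isCompact_Icc (a := -(K : ℝ)) (b := K))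
      ).exists_bound_of_continuousOn ((hHt.cont e).mono (prod_mono_right (subset_univ _)))
    refine ⟨B, ?_⟩
    simp only [hS, mem_ofPred_eq]
    -- The curve is arbitrary outside `[0, len e]`, so `deriv` is controlled at interior parameters
    -- only.
    rw [← restrict_Ioo_eq_restrict_Icc]
    filter_upwards [ae_restrict_mem measurableSet_Ioo] with s hs
    have h3 : |deriv (fun σ => g (N.curve e σ)) s| ≤ K :=
      norm_deriv_le_of_lipschitzOn (Icc_mem_nhds hs.1 hs.2) hG
    exact (le_abs_self _).trans (hB (s, _) ⟨Ioo_subset_Icc_self hs, abs_le.1 h3⟩)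
  have h1 : sInf S ≤ N.M0 Ht g :=
    le_ciSup (f := fun e : N.Arc => sInf {m : ℝ | ∀ᵐ s ∂(volume.restrict (Icc 0 (N.len e))),
      Ht e s (deriv (fun σ => g (N.curve e σ)) s) ≤ m}) (finite_range _).bddAbove e
  obtain ⟨m, hm, hlt⟩ := exists_lt_of_csInf_lt hne (lt_add_one (sInf S))
  refine ⟨m, hlt.trans_le ?_, hm⟩
  exact (by linarith : sInf S + 1 ≤ N.M0 Ht g + 1).trans (le_max_left _ _)

/-- The function `g - A t` is a subsolution. -/
lemma isOpenSubsolution_barrier (hHt : N.IsHamiltonian Ht) {K : NNReal}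
    (hg : LipschitzOnWith K g N.support) :
    N.IsOpenSubsolution Ht c T fun x t => g x - N.level Ht g c * t where
  cont := by
    have h1 : ContinuousOn (fun p : EuclideanSpace ℝ (Fin d) × ℝ => g p.1) (N.support ×ˢ Icc 0 T) :=
      hg.continuousOn.comp continuousOn_fst fun p hp => hp.1
    exact h1.sub (by fun_prop)
  interior e s hs t ht φ hφ hmax := by
    have hG : LipschitzOnWith K (fun σ => g (N.curve e σ)) (Icc 0 (N.len e)) := by
      have := hg.comp (lipschitzOnWith_curve e) fun s hs => N.curve_mem_support e hs
      rwa [mul_one] at this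
    obtain ⟨m, hm, hae⟩ := exists_ae_le_lt_level (c := c) hHt hg e
    have hφd := hφ.differentiable one_ne_zero
    have hd1 : DifferentiableAt ℝ (fun τ => φ (s, τ)) t := by fun_prop
    have hd2 : DifferentiableAt ℝ (fun σ => φ (σ, t)) s := by fun_prop
    have ht1 : deriv (fun τ => φ (s, τ)) t = -N.level Ht g c := by
      have hloc : IsLocalMax (fun τ => g (N.curve e s) - N.level Ht g c * τ - φ (s, τ)) t := by
        have hc : Filter.Tendsto (fun τ : ℝ => (s, τ)) (nhds t) (nhds (s, t)) :=
          (by fun_prop : Continuous fun τ : ℝ => (s, τ)).tendsto t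
        exact hc.eventually hmax
      have := hloc.hasDerivAt_eq_zero
        ((((hasDerivAt_id t).const_mul (N.level Ht g c)).const_sub _).sub hd1.hasDerivAt)
      simp only [mul_one] at this
      linarith
    have hs1 : Ht e s (deriv (fun σ => φ (σ, t)) s) ≤ N.level Ht g c := by
      refine hamiltonian_le_of_ae (hHt.isCoerciveH e) hG hm hae hs hd2 ?_
      have hc : Filter.Tendsto (fun σ : ℝ => (σ, t)) (nhds s) (nhds (s, t)) :=
        (by fun_prop : Continuous fun σ : ℝ => (σ, t)).tendsto s
      filter_upwards [hc.eventually hmax] with σ hσ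
      linarith
    rw [residual, ht1]
    linarith
  -- A test function touching `g - A t` in time has slope `-A ≤ -|c x| ≤ c x`.
  vertex x t _ ψ hψ hmax := by
    have := hmax.hasDerivAt_eq_zero
      ((((hasDerivAt_id t).const_mul (N.level Ht g c)).const_sub _).sub
        (hψ.differentiable one_ne_zero t).hasDerivAt)
    simp only [mul_one] at this
    have h := neg_abs_le (c x)
    have h' := abs_le_level (Ht := Ht) (g := g) (c := c) x
    linarith

/-! ### Monotonicity, restriction and time shifts -/

lemma IsOpenSubsolution.mono {H' : N.Arc → ℝ → ℝ → ℝ} (hu : N.IsOpenSubsolution H c T u)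
    (hle : ∀ e, ∀ s ∈ Icc 0 (N.len e), ∀ μ, H' e s μ ≤ H e s μ) :
    N.IsOpenSubsolution H' c T u where
  cont := hu.cont
  interior e s hs t ht φ hφ hmax := by
    have h1 := hu.interior e s hs t ht φ hφ hmax
    have h2 := hle e s (Ioo_subset_Icc_self hs) (deriv (fun σ => φ (σ, t)) s)
    simp only [residual] at h1 ⊢
    linarith
  vertex := hu.vertex

lemma IsSubsolution.mono {H' : N.Arc → ℝ → ℝ → ℝ} (hu : N.IsSubsolution H g c T u)
    (hle : ∀ e, ∀ s ∈ Icc 0 (N.len e), ∀ μ, H' e s μ ≤ H e s μ) :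
    N.IsSubsolution H' g c T u where
  cont := hu.cont
  initial := hu.initial
  interior e s hs t ht φ hφ hmax := by
    have h1 := hu.interior e s hs t ht φ hφ hmax
    have h2 := hle e s (Ioo_subset_Icc_self hs) (deriv (fun σ => φ (σ, t)) s)
    simp only [residual] at h1 ⊢
    linarith
  vertex := hu.vertex

lemma endpoint_mem {e : N.Arc} {s : ℝ} (hs : s = 0 ∨ s = N.len e) : s ∈ Icc 0 (N.len e) := by
  have := (N.len_pos e).le
  rcases hs with rfl | rfl
  · exact ⟨le_rfl, this⟩
  · exact ⟨this, le_rfl⟩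

lemma IsSupersolution.mono {H' : N.Arc → ℝ → ℝ → ℝ} (hu : N.IsSupersolution P H g c T u)
    (hle : ∀ e, ∀ s ∈ Icc 0 (N.len e), ∀ μ, H e s μ ≤ H' e s μ) :
    N.IsSupersolution P H' g c T u where
  cont := hu.cont
  initial := hu.initial
  interior e s hs t ht φ hφ hmin := by
    have h1 := hu.interior e s hs t ht φ hφ hmin
    have h2 := hle e s (Ioo_subset_Icc_self hs) (deriv (fun σ => φ (σ, t)) s)
    simp only [residual] at h1 ⊢
    linarith
  vertex x t ht hψ := by
    obtain ⟨e, he, s, hs, hsx, h⟩ := hu.vertex x t ht hψ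
    refine ⟨e, he, s, hs, hsx, fun φ hφ hmin => ?_⟩
    have h1 := h φ hφ hmin
    have h2 := hle e s (endpoint_mem hs) (deriv (fun σ => φ (σ, t)) s)
    simp only [residual] at h1 ⊢
    linarith

lemma IsSubsolution.isOpenSubsolution (hu : N.IsSubsolution H g c T u) {T' : ℝ} (hT' : T' ≤ T) :
    N.IsOpenSubsolution H c T' u where
  cont := hu.cont.mono (prod_mono_right (Icc_subset_Icc_right hT'))
  interior e s hs t ht := hu.interior e s hs t ⟨ht.1, ht.2.trans_le hT'⟩
  vertex x t ht ψ hψ hmax := hu.vertex x t ⟨ht.1, ht.2.le.trans hT'⟩ ψ hψ (hmax.on _)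

lemma IsSupersolution.isOpenSupersolution (hu : N.IsSupersolution P H g c T u) :
    N.IsOpenSupersolution P H c T u where
  cont := hu.cont
  interior := hu.interior
  vertex x t ht := fun ⟨ψ, hψ, hmin, h⟩ =>
    hu.vertex x t ⟨ht.1, ht.2.le⟩ ⟨ψ, hψ, hmin.on _, h⟩

lemma residual_time_shift (H : ℝ → ℝ → ℝ) (φ : ℝ × ℝ → ℝ) (h s t : ℝ) :
    residual H (fun p => φ (p.1, p.2 - h)) s t = residual H φ s (t - h) := by
  simp only [residual]
  rw [deriv_comp_sub_const (f := fun τ => φ (s, τ))]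

/-- Time shifts, and addition of constants, preserve supersolutions. -/
lemma IsOpenSupersolution.shift (hu : N.IsOpenSupersolution P H c T u) {h : ℝ} (hh : 0 ≤ h)
    (a : ℝ) : N.IsOpenSupersolution P H c (T - h) fun x t => u x (t + h) + a where
  cont := by
    have : ContinuousOn (fun p : EuclideanSpace ℝ (Fin d) × ℝ => u p.1 (p.2 + h))
        (N.support ×ˢ Icc 0 (T - h)) :=
      hu.cont.comp (f := fun p : EuclideanSpace ℝ (Fin d) × ℝ => (p.1, p.2 + h)) (by fun_prop)
        fun p hp => ⟨hp.1, by linarith [hp.2.1], by linarith [hp.2.2]⟩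
    exact this.add continuousOn_const
  interior e s hs t ht φ hφ hmin := by
    have hcd : ContDiff ℝ 1 (fun p : ℝ × ℝ => φ (p.1, p.2 - h)) :=
      hφ.comp (by fun_prop : ContDiff ℝ 1 (fun p : ℝ × ℝ => (p.1, p.2 - h)))
    have hres := hu.interior e s hs (t + h) ⟨by linarith [ht.1], by linarith [ht.2]⟩ _ hcd (by
      have hc : Filter.Tendsto (fun p : ℝ × ℝ => (p.1, p.2 - h)) (nhds (s, t + h))
          (nhds (s, t)) := by
        simpa using (by fun_prop : Continuous fun p : ℝ × ℝ => (p.1, p.2 - h)).tendsto (s, t + h)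
      filter_upwards [hc.eventually hmin] with p hp
      simp only [sub_add_cancel, add_sub_cancel_right] at hp ⊢
      linarith)
    rwa [residual_time_shift, add_sub_cancel_right] at hres
  vertex x t ht := by
    rintro ⟨ψ, hψ, hmin, hlt⟩
    have hth : t + h ∈ Ioo 0 T := ⟨by linarith [ht.1], by linarith [ht.2]⟩
    obtain ⟨e, he, s, hs, hsx, hφ⟩ := hu.vertex x (t + h) hth (by
      refine ⟨fun τ => ψ (τ - h), by fun_prop, ?_, ?_⟩
      · have hc : Filter.Tendsto (fun τ : ℝ => τ - h) (nhds (t + h)) (nhds t) := by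
          simpa using (by fun_prop : Continuous fun τ : ℝ => τ - h).tendsto (t + h)
        filter_upwards [hc.eventually hmin] with τ hτ
        simp only [sub_add_cancel, add_sub_cancel_right] at hτ ⊢
        linarith
      · rwa [deriv_comp_sub_const, add_sub_cancel_right])
    refine ⟨e, he, s, hs, hsx, fun φ hφc hφmin => ?_⟩
    have hcd : ContDiff ℝ 1 (fun p : ℝ × ℝ => φ (p.1, p.2 - h)) :=
      hφc.comp (by fun_prop : ContDiff ℝ 1 (fun p : ℝ × ℝ => (p.1, p.2 - h)))
    have hres := hφ _ hcd (by
      have hcont : Continuous fun p : ℝ × ℝ => (p.1, p.2 - h) := by fun_prop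
      have hc : Filter.Tendsto (fun p : ℝ × ℝ => (p.1, p.2 - h))
          (nhdsWithin (s, t + h) (Icc 0 (N.len e) ×ˢ Icc 0 T))
          (nhdsWithin (s, t) (Icc 0 (N.len e) ×ˢ Icc 0 (T - h))) := by
        refine tendsto_nhdsWithin_iff.2 ⟨?_, ?_⟩
        · have := hcont.tendsto (s, t + h)
          simp only [add_sub_cancel_right] at this
          exact this.mono_left nhdsWithin_le_nhds
        -- As `t` is interior to `(0, T - h)`, the time constraint is void near the point; only the
        -- constraint in space remains.
        · have hev : ∀ᶠ p : ℝ × ℝ in nhds (s, t + h), p.2 - h ∈ Icc 0 (T - h) := by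
            have h2 : Continuous fun p : ℝ × ℝ => p.2 - h := by fun_prop
            refine h2.continuousAt.eventually_mem ?_
            simpa using Icc_mem_nhds ht.1 ht.2
          filter_upwards [hev.filter_mono nhdsWithin_le_nhds, self_mem_nhdsWithin] with p h1 h2
          exact ⟨h2.1, h1⟩
      filter_upwards [hc.eventually hφmin] with p hp
      simp only [sub_add_cancel, add_sub_cancel_right] at hp ⊢
      linarith)
    rwa [residual_time_shift, add_sub_cancel_right] at hres

/-! ### Rate bound in time and exchange of Hamiltonians -/

/-- Solutions decrease in time at most at the rate `A`, if `g - A t` is a subsolution. -/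
lemma IsSolution.time_lower_bound (hT : 0 < T) (hH : ∀ e, IsCoerciveH (H e) (N.len e))
    (hflux : ∀ x : N.vertices, ∀ e ∈ P, ∀ s, (s = 0 ∨ s = N.len e) → N.curve e s = x →
      ∃ q, H e s q ≤ -c x) {A : ℝ}
    (hbar : N.IsOpenSubsolution H c T fun x t => g x - A * t) (hu : N.IsSolution P H g c T u) :
    ∀ x ∈ N.support, ∀ t ∈ Icc 0 T, ∀ t' ∈ Icc 0 T, t ≤ t' → u x t - A * (t' - t) ≤ u x t' := by
  have hsup := hu.2.isOpenSupersolution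
  have hb := comparison hT hH hflux hbar hsup fun x hx => by simpa using hu.2.initial x hx
  intro x hx t ht t' ht' htt'
  set h := t' - t with hh
  have hh0 : 0 ≤ h := by linarith
  rcases lt_or_ge h T with hhT | hhT
  -- The shifted supersolution starts above `u`, because `u y 0 ≤ g y ≤ u y h + A * h` by the
  -- barrier.
  · have := comparison (T := T - h) (by linarith) hH hflux
      (hu.1.isOpenSubsolution (by linarith)) (hsup.shift hh0 (A * h)) (fun y hy => by
        have h1 := hb y hy h ⟨hh0, hhT.le⟩
        have h2 := hu.1.initial y hy
        simp only [zero_add]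
        linarith) x hx t ⟨ht.1, by linarith [ht'.2]⟩
    have e : t + h = t' := by rw [hh]; ring
    rw [e] at this
    linarith
  -- Here `t = 0` and `t' = T`: the shifted interval is degenerate and the barrier alone gives the
  -- bound.
  · have h1 : t = 0 := by linarith [ht.1, ht'.2]
    subst h1
    have h2 := hb x hx t' ht'
    have h3 := hu.1.initial x hx
    rw [hh]
    linarith

/-- Two Hamiltonians which agree where one of them is at most `A` have the same subsolutions among
functions decreasing in time at most at the rate `A`. -/
lemma IsSubsolution.of_time_lower_bound {H' : N.Arc → ℝ → ℝ → ℝ} {A : ℝ}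
    (hu : N.IsSubsolution H g c T u)
    (hA : ∀ x ∈ N.support, ∀ t ∈ Icc 0 T, ∀ t' ∈ Icc 0 T, t ≤ t' → u x t - A * (t' - t) ≤ u x t')
    (heq : ∀ e, ∀ s ∈ Icc 0 (N.len e), ∀ μ, H e s μ = H' e s μ ∨ A < H e s μ) :
    N.IsSubsolution H' g c T u where
  cont := hu.cont
  initial := hu.initial
  vertex := hu.vertex
  interior e s hs t ht φ hφ hmax := by
    have h1 := hu.interior e s hs t ht φ hφ hmax
    have hφd := hφ.differentiable one_ne_zero
    have hd1 : DifferentiableAt ℝ (fun τ => φ (s, τ)) t := by fun_prop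
    -- At a local maximum of `u - φ`, increments of `φ` towards the future dominate those of `u`.
    have hφt : -A ≤ deriv (fun τ => φ (s, τ)) t := by
      refine le_deriv_of_forall_right hd1.hasDerivAt ?_
      have hc : Filter.Tendsto (fun x : ℝ => (s, t + x)) (nhds 0) (nhds (s, t)) := by
        simpa using (by fun_prop : Continuous fun x : ℝ => (s, t + x)).tendsto 0
      filter_upwards [(hc.eventually hmax).filter_mono nhdsWithin_le_nhds,
        Ioo_mem_nhdsGT (sub_pos.2 ht.2)] with x hx hx'
      have h2 := hA _ (N.curve_mem_support e (Ioo_subset_Icc_self hs)) t (Ioo_subset_Icc_self ht)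
        (t + x) ⟨by linarith [ht.1, hx'.1], by linarith [hx'.2]⟩ (by linarith [hx'.1])
      rw [add_sub_cancel_left] at h2
      linarith
    simp only [residual] at h1 ⊢
    rcases heq e s (Ioo_subset_Icc_self hs) (deriv (fun σ => φ (σ, t)) s) with h | h
    · rwa [← h]
    · linarith

/-- The analogous property for supersolutions. -/
lemma IsSupersolution.of_time_lower_bound {H' : N.Arc → ℝ → ℝ → ℝ} {A : ℝ}
    (hu : N.IsSupersolution P H g c T u)
    (hA : ∀ x ∈ N.support, ∀ t ∈ Icc 0 T, ∀ t' ∈ Icc 0 T, t ≤ t' → u x t - A * (t' - t) ≤ u x t')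
    (heq : ∀ e, ∀ s ∈ Icc 0 (N.len e), ∀ μ, H' e s μ = H e s μ ∨ A < H' e s μ) :
    N.IsSupersolution P H' g c T u := by
  have key : ∀ e, ∀ s ∈ Icc 0 (N.len e), ∀ t ∈ Ioc 0 T, ∀ φ : ℝ × ℝ → ℝ, ContDiff ℝ 1 φ →
      IsLocalMinOn (fun p : ℝ × ℝ => u (N.curve e p.1) p.2 - φ p)
        (Icc 0 (N.len e) ×ˢ Icc 0 T) (s, t) → 0 ≤ residual (H e) φ s t →
      0 ≤ residual (H' e) φ s t := by
    intro e s hs t ht φ hφ hmin h1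
    have hφd := hφ.differentiable one_ne_zero
    have hd1 : DifferentiableAt ℝ (fun τ => φ (s, τ)) t := by fun_prop
    -- At a minimum it is the past that gives the bound, which also covers `t = T` in the vertex
    -- condition.
    have hφt : -A ≤ deriv (fun τ => φ (s, τ)) t := by
      refine le_deriv_of_forall_left hd1.hasDerivAt ?_
      have hIoo : ∀ᶠ x in nhdsWithin (0 : ℝ) (Ioi 0), x ∈ Ioo 0 t := Ioo_mem_nhdsGT ht.1
      have hc : Filter.Tendsto (fun x : ℝ => (s, t - x)) (nhdsWithin 0 (Ioi 0))
          (nhdsWithin (s, t) (Icc 0 (N.len e) ×ˢ Icc 0 T)) := by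
        refine tendsto_nhdsWithin_iff.2 ⟨?_, ?_⟩
        · have := (by fun_prop : Continuous fun x : ℝ => (s, t - x)).tendsto 0
          simp only [sub_zero] at this
          exact this.mono_left nhdsWithin_le_nhds
        · filter_upwards [hIoo] with x hx
          exact ⟨hs, by linarith [hx.2], by linarith [hx.1, ht.2]⟩
      filter_upwards [hc.eventually hmin, hIoo] with x hx hx'
      have h2 := hA _ (N.curve_mem_support e hs) (t - x)
        ⟨by linarith [hx'.2], by linarith [hx'.1, ht.2]⟩ t ⟨ht.1.le, ht.2⟩ (by linarith [hx'.1])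
      rw [sub_sub_cancel] at h2
      linarith
    simp only [residual] at h1 ⊢
    rcases heq e s hs (deriv (fun σ => φ (σ, t)) s) with h | h
    · rwa [h]
    · linarith
  exact
    { cont := hu.cont
      initial := hu.initial
      interior := fun e s hs t ht φ hφ hmin =>
        key e s (Ioo_subset_Icc_self hs) t ⟨ht.1, ht.2.le⟩ φ hφ (hmin.on _)
          (hu.interior e s hs t ht φ hφ hmin)
      vertex := fun x t ht hψ => by
        obtain ⟨e, he, s, hs, hsx, h⟩ := hu.vertex x t ht hψ
        exact ⟨e, he, s, hs, hsx, fun φ hφ hmin =>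
          key e s (endpoint_mem hs) t ht φ hφ hmin (h φ hφ hmin)⟩ }

end Network

end HJNetwork

end

/-! ### The equivalence of the two problems -/

theorem theorem2p3 {d : ℕ} (N : HJNetwork.Network d)
    (P : Set N.Arc) (hP : N.IsOrientation P)
    (Ht : N.Arc → ℝ → ℝ → ℝ) (hHt : N.IsHamiltonian Ht)
    (c : N.vertices → ℝ) (hc : N.IsFluxLimiter P Ht c)
    (g : EuclideanSpace ℝ (Fin d) → ℝ) (hg : ∃ K, LipschitzOnWith K g N.support)
    (T : ℝ) (hT : 0 < T)
    (i₁ i₂ : ℝ) (hI : N.MomentumCondition Ht g c (Set.Icc i₁ i₂))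
    (β₀ μ₀ : N.Arc → ℝ)
    (hcut : ∀ e, HJNetwork.IsCutoff (Ht e) (N.len e) i₁ i₂ (β₀ e) (μ₀ e))
    (hβ₀ : ∀ e, β₀ (N.rev e) = β₀ e) (hμ₀ : ∀ e, μ₀ (N.rev e) = μ₀ e)
    (H : N.Arc → ℝ → ℝ → ℝ) (hH : ∀ e, H e = HJNetwork.modifiedH (Ht e) (β₀ e) (μ₀ e)) :
    (∀ u : EuclideanSpace ℝ (Fin d) → ℝ → ℝ,
      N.IsSolution P Ht g c T u ↔ N.IsSolution P H g c T u) ∧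
    (∀ u v : EuclideanSpace ℝ (Fin d) → ℝ → ℝ,
      N.IsSolution P Ht g c T u → N.IsSolution P H g c T v →
        ∀ x ∈ N.support, ∀ t ∈ Set.Icc 0 T, u x t = v x t) ∧
    (∀ u : EuclideanSpace ℝ (Fin d) → ℝ → ℝ,
      N.IsSubsolution Ht g c T u → N.IsSubsolution H g c T u) ∧
    (∀ u : EuclideanSpace ℝ (Fin d) → ℝ → ℝ,
      (∀ x ∈ N.support, ∀ t ∈ Set.Icc 0 T, ∀ t' ∈ Set.Icc 0 T,
        |u x t - u x t'| ≤ N.level Ht g c * |t - t'|) →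
      N.IsSubsolution H g c T u → N.IsSubsolution Ht g c T u) := by
  have hcoT : ∀ e, HJNetwork.IsCoerciveH (Ht e) (N.len e) := hHt.isCoerciveH
  have hco : ∀ e, HJNetwork.IsCoerciveH (H e) (N.len e) := fun e => by
    rw [hH e]; exact HJNetwork.isCoerciveH_modifiedH (hcut e) (hcoT e)
  have hle : ∀ e, ∀ s ∈ Set.Icc 0 (N.len e), ∀ μ, H e s μ ≤ Ht e s μ := fun e s hs μ => by
    rw [hH e]; exact HJNetwork.modifiedH_le (hcut e) (hcoT e) hs μ
  -- This alternative is stated in terms of the modified Hamiltonian because both exchange lemmas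
  -- test its value against `A`.
  have heq : ∀ e, ∀ s ∈ Set.Icc 0 (N.len e), ∀ μ,
      H e s μ = Ht e s μ ∨ N.level Ht g c < H e s μ := by
    intro e s hs μ
    rw [hH e]
    by_cases hμ : μ ∈ Set.Icc i₁ i₂
    · obtain ⟨j₁, j₂, hj₁, hj₂, h⟩ := HJNetwork.exists_modifiedH_eq (hcut e) (hcoT e)
      exact Or.inl (h s hs μ ⟨hj₁.trans_le hμ.1, hμ.2.trans_lt hj₂⟩)
    · exact Or.inr (HJNetwork.lt_modifiedH (hcut e) (hcoT e) hs
        (fun ν hν => (hI ν hν).2 ν le_rfl e s hs)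
        (HJNetwork.Network.exists_le_level hP hHt hc e hs) hμ)
  have hfluxT : ∀ x : N.vertices, ∀ e ∈ P, ∀ s, (s = 0 ∨ s = N.len e) → N.curve e s = x →
      ∃ q, Ht e s q ≤ -c x := by
    intro x e he s hs hsx
    refine hc.exists_le hHt x he ?_ (HJNetwork.Network.endpoint_mem hs)
    rcases hs with rfl | rfl
    · exact Or.inl hsx.symm
    · exact Or.inr hsx.symm
  have hflux : ∀ x : N.vertices, ∀ e ∈ P, ∀ s, (s = 0 ∨ s = N.len e) → N.curve e s = x →
      ∃ q, H e s q ≤ -c x := fun x e he s hs hsx =>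
    (hfluxT x e he s hs hsx).imp fun q hq =>
      (hle e s (HJNetwork.Network.endpoint_mem hs) q).trans hq
  obtain ⟨K, hK⟩ := hg
  have hbarT : N.IsOpenSubsolution Ht c T fun x t => g x - N.level Ht g c * t :=
    HJNetwork.Network.isOpenSubsolution_barrier hHt hK
  have hiff : ∀ u : EuclideanSpace ℝ (Fin d) → ℝ → ℝ,
      N.IsSolution P Ht g c T u ↔ N.IsSolution P H g c T u := by
    refine fun u => ⟨fun hu => ⟨hu.1.mono hle, ?_⟩, fun hu => ⟨?_, hu.2.mono hle⟩⟩
    · exact hu.2.of_time_lower_bound (hu.time_lower_bound hT hcoT hfluxT hbarT) heq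
    -- The barrier is built for the original Hamiltonians and remains a subsolution for the smaller
    -- modified ones.
    · exact hu.1.of_time_lower_bound (hu.time_lower_bound hT hco hflux (hbarT.mono hle)) heq
  refine ⟨hiff, fun u v hu hv x hx t ht => ?_, fun u hu => hu.mono hle, fun u hlip hu => ?_⟩
  · have hv' := (hiff v).2 hv
    have hcmp : ∀ w w' : EuclideanSpace ℝ (Fin d) → ℝ → ℝ, N.IsSolution P Ht g c T w →
        N.IsSolution P Ht g c T w' → w x t ≤ w' x t := fun w w' hw hw' =>
      HJNetwork.Network.comparison hT hcoT hfluxT (hw.1.isOpenSubsolution le_rfl)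
        hw'.2.isOpenSupersolution
        (fun y hy => (hw.1.initial y hy).trans (hw'.2.initial y hy)) x hx t ht
    exact (hcmp u v hu hv').antisymm (hcmp v u hv' hu)
  · refine hu.of_time_lower_bound (fun x hx t ht t' ht' htt' => ?_) heq
    have h := hlip x hx t ht t' ht'
    rw [abs_of_nonpos (sub_nonpos.2 htt')] at h
    linarith [le_abs_self (u x t - u x t')]
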